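/- Let $d>0$ and let $\Omega=\{(x,y)\in\mathbb{R}^2:\ x\ge 0,\ y\ge 0,\ |x-y|\le d\}$ be the pencil-shaped domain, with $\partial\Omega_D=\{(x,y)\in\Omega:\ |x-y|=d\}$. Let $-\Delta^{d}_{\sigma=0,\alpha=0}$ be the operator in the complex Hilbert space $L^2(\Omega)$ associated with the quadratic form $$q[\varphi]=\int_\Omega|\nabla\varphi|^2\,\mathrm{d}x\,\mathrm{d}y,\qquad \mathcal{D}_q=\{\varphi\in H^1(\Omega):\ \varphi|_{\partial\Omega_D}=0\},$$ where $\varphi|_{\partial\Omega_D}$ is the Sobolev trace; that is, $u$ belongs to its domain with $-\Delta^{d}_{\sigma=0,\alpha=0}u=f\in L^2(\Omega)$ if and only if $u\in\mathcal{D}_q$ and $\int_\Omega\overline{\nabla v}\cdot\nabla u=\int_\Omega\overline{v}f$ for all $v\in\mathcal{D}_q$. (This is the Laplacian on $\Omega$ with Dirichlet conditions on $\partial\Omega_D$ and Neumann conditions on the rest of the boundary.) Then $-\Delta^{d}_{\sigma=0,\alpha=0}$ is self-adjoint, and its discrete spectrum (the set of eigenvalues of finite multiplicity that are isolated points of the spectrum)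 is non-empty: $$\sigma_d\bigl(-\Delta^{d}_{\sigma=0,\alpha=0}\bigr)\neq\emptyset .$$ More precisely, it contains an eigenvalue $E<\pi^2/(2d^2)$. -/

import Mathlib

open MeasureTheory Filter Topology
open scoped ContDiff

noncomputable section

namespace PencilSpectrum

/-! ### Sobolev space `H¹` and traces on a planar region -/

/-- The complex Hilbert space `L²(Ω)` with respect to Lebesgue measure, `Ω ⊆ ℝ²`. -/
abbrev L2 (Ω : Set (ℝ × ℝ)) : Type := Lp ℂ 2 ((volume : Measure (ℝ × ℝ)).restrict Ω)

/-- Test functions: smooth, with compact support contained in the interior of `Ω`. -/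
def IsTestFunction (Ω : Set (ℝ × ℝ)) (φ : ℝ × ℝ → ℂ) : Prop :=
  ContDiff ℝ ∞ φ ∧ HasCompactSupport φ ∧ tsupport φ ⊆ interior Ω

lemma IsTestFunction.memLp {Ω : Set (ℝ × ℝ)} {φ : ℝ × ℝ → ℂ} (h : IsTestFunction Ω φ) :
    MemLp φ 2 ((volume : Measure (ℝ × ℝ)).restrict Ω) :=
  h.1.continuous.memLp_of_hasCompactSupport h.2.1

lemma continuous_partial {φ : ℝ × ℝ → ℂ} (h : ContDiff ℝ ∞ φ) (e : ℝ × ℝ) :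
    Continuous (fun p => fderiv ℝ φ p e) :=
  (h.continuous_fderiv (by simp)).clm_apply continuous_const

lemma hasCompactSupport_partial {φ : ℝ × ℝ → ℂ} (h : HasCompactSupport φ) (e : ℝ × ℝ) :
    HasCompactSupport (fun p => fderiv ℝ φ p e) :=
  h.fderiv_apply (𝕜 := ℝ) e

lemma IsTestFunction.memLp_partial {Ω : Set (ℝ × ℝ)} {φ : ℝ × ℝ → ℂ} (h : IsTestFunction Ω φ)
    (e : ℝ × ℝ) :
    MemLp (fun p => fderiv ℝ φ p e) 2 ((volume : Measure (ℝ × ℝ)).restrict Ω) :=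
  (continuous_partial h.1 e).memLp_of_hasCompactSupport (hasCompactSupport_partial h.2.1 e)

lemma integrable_mul {Ω : Set (ℝ × ℝ)} (u : L2 Ω) {φ : ℝ × ℝ → ℂ}
    (h : MemLp φ 2 ((volume : Measure (ℝ × ℝ)).restrict Ω)) :
    Integrable (fun p => u p * φ p) ((volume : Measure (ℝ × ℝ)).restrict Ω) :=
  (Lp.memLp u).integrable_mul h

/-- The set of pairs `(u, w)` in `L²(Ω) × L²(Ω)` such that `w` is the weak derivative of `u` in
the direction `e`. -/
def weakPartialGraph (Ω : Set (ℝ × ℝ)) (e : ℝ × ℝ) : Submodule ℂ (L2 Ω × L2 Ω) where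
  carrier := {q | ∀ φ : ℝ × ℝ → ℂ, IsTestFunction Ω φ →
    ∫ p in Ω, q.1 p * fderiv ℝ φ p e = - ∫ p in Ω, q.2 p * φ p}
  zero_mem' := by
    intro φ _
    have h0 : ((0 : L2 Ω) : ℝ × ℝ → ℂ) =ᵐ[volume.restrict Ω] 0 := Lp.coeFn_zero _ _ _
    have h1 : ∀ ψ : ℝ × ℝ → ℂ, ∫ p in Ω, (0 : L2 Ω) p * ψ p = 0 := by
      intro ψ
      rw [integral_congr_ae (g := fun _ => (0 : ℂ)) (h0.mono fun p hp => by simp only [hp, Pi.zero_apply, zero_mul])]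
      simp
    simp only [Prod.fst_zero, Prod.snd_zero, h1, neg_zero]
  add_mem' := by
    intro a b ha hb φ hφ
    have key : ∀ (u v : L2 Ω) (ψ : ℝ × ℝ → ℂ), MemLp ψ 2 (volume.restrict Ω) →
        ∫ p in Ω, (u + v) p * ψ p = (∫ p in Ω, u p * ψ p) + ∫ p in Ω, v p * ψ p := by
      intro u v ψ hψ
      rw [← integral_add (integrable_mul u hψ) (integrable_mul v hψ)]
      exact integral_congr_ae ((Lp.coeFn_add u v).mono fun p hp => by
        simp only [hp, Pi.add_apply, add_mul])
    rw [Prod.fst_add, Prod.snd_add, key _ _ _ (hφ.memLp_partial e), key _ _ _ hφ.memLp,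
      ha φ hφ, hb φ hφ]
    ring
  smul_mem' := by
    intro c a ha φ hφ
    have key : ∀ (u : L2 Ω) (ψ : ℝ × ℝ → ℂ),
        ∫ p in Ω, (c • u) p * ψ p = c * ∫ p in Ω, u p * ψ p := by
      intro u ψ
      rw [← integral_const_mul]
      exact integral_congr_ae ((Lp.coeFn_smul c u).mono fun p hp => by
        simp only [hp, Pi.smul_apply, smul_eq_mul, mul_assoc])
    rw [Prod.smul_fst, Prod.smul_snd, key, key, ha φ hφ]
    ring

/-- The weak derivative in the direction `e`, as an unbounded operator on `L²(Ω)`. -/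
def weakPartial (Ω : Set (ℝ × ℝ)) (e : ℝ × ℝ) : L2 Ω →ₗ.[ℂ] L2 Ω :=
  (weakPartialGraph Ω e).toLinearPMap

/-- An `L²(Ω)` function orthogonal to all test functions vanishes, if `∂Ω` is a null set. -/
lemma eq_zero_of_forall_test {Ω : Set (ℝ × ℝ)} (hΩ : volume (frontier Ω) = 0) (w : L2 Ω)
    (h : ∀ φ : ℝ × ℝ → ℂ, IsTestFunction Ω φ → ∫ p in Ω, w p * φ p = 0) : w = 0 := by
  have hloc : LocallyIntegrableOn (w : ℝ × ℝ → ℂ) (interior Ω)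
      ((volume : Measure (ℝ × ℝ)).restrict Ω) :=
    ((Lp.memLp w).locallyIntegrable (by norm_num)).locallyIntegrableOn _
  have h1 := isOpen_interior.ae_eq_zero_of_integral_contDiff_smul_eq_zero hloc (by
    intro g hg hgc hgs
    have hsupp : tsupport (fun p => (g p : ℂ)) ⊆ tsupport g :=
      closure_mono fun p hp => by
        simp only [Function.mem_support, ne_eq, Complex.ofReal_eq_zero] at hp ⊢
        exact hp
    have := h (fun p => (g p : ℂ)) ⟨Complex.ofRealCLM.contDiff.comp hg,
      hgc.comp_left (g := fun x : ℝ => (x : ℂ)) (by simp), hsupp.trans hgs⟩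
    rw [← this]
    refine integral_congr_ae (ae_of_all _ fun p => ?_)
    simp [mul_comm])
  rw [Lp.eq_zero_iff_ae_eq_zero]
  have h2 : ∀ᵐ p ∂(volume : Measure (ℝ × ℝ)).restrict Ω, p ∈ interior Ω := by
    have h3 : ∀ᵐ p ∂(volume : Measure (ℝ × ℝ)), p ∉ frontier Ω := measure_eq_zero_iff_ae_notMem.1 hΩ
    have h4 : NullMeasurableSet Ω (volume : Measure (ℝ × ℝ)) := nullMeasurableSet_of_null_frontier hΩ
    filter_upwards [ae_restrict_of_ae h3, ae_restrict_mem₀ h4] with p hp hp'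
    by_contra hcon
    exact hp ⟨subset_closure hp', hcon⟩
  filter_upwards [h1, h2] with p hp hp'
  exact hp hp'

/-- Weak derivatives are unique. -/
lemma weakPartial_graph {Ω : Set (ℝ × ℝ)} (hΩ : volume (frontier Ω) = 0) (e : ℝ × ℝ) :
    (weakPartial Ω e).graph = weakPartialGraph Ω e := by
  refine Submodule.toLinearPMap_graph_eq _ ?_
  rintro ⟨u, w⟩ hx (rfl : u = 0)
  refine eq_zero_of_forall_test hΩ w fun φ hφ => ?_
  have h := hx φ hφ
  have h0 : ∫ p in Ω, (0 : L2 Ω) p * fderiv ℝ φ p e = 0 := by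
    rw [integral_congr_ae (g := fun _ => (0 : ℂ))
      ((Lp.coeFn_zero ℂ 2 _).mono fun p hp => by simp only [hp, Pi.zero_apply, zero_mul])]
    simp
  simp only [h0] at h
  exact neg_eq_zero.1 h.symm

/-- The Sobolev space `H¹(Ω)`. -/
def H1 (Ω : Set (ℝ × ℝ)) : Submodule ℂ (L2 Ω) :=
  (weakPartial Ω (1, 0)).domain ⊓ (weakPartial Ω (0, 1)).domain

/-- The weak derivative `∂u/∂x` of `u ∈ H¹(Ω)`. -/
def dx {Ω : Set (ℝ × ℝ)} : H1 Ω →ₗ[ℂ] L2 Ω :=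
  (weakPartial Ω (1, 0)).toFun ∘ₗ Submodule.inclusion inf_le_left

/-- The weak derivative `∂u/∂y` of `u ∈ H¹(Ω)`. -/
def dy {Ω : Set (ℝ × ℝ)} : H1 Ω →ₗ[ℂ] L2 Ω :=
  (weakPartial Ω (0, 1)).toFun ∘ₗ Submodule.inclusion inf_le_right

lemma dx_eq {Ω : Set (ℝ × ℝ)} {u : H1 Ω} {w : L2 Ω}
    (h : ((u : L2 Ω), w) ∈ (weakPartial Ω (1, 0)).graph) : dx u = w :=
  LinearPMap.mem_graph_snd_inj _ (LinearPMap.mem_graph _ _) h rfl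

lemma dy_eq {Ω : Set (ℝ × ℝ)} {u : H1 Ω} {w : L2 Ω}
    (h : ((u : L2 Ω), w) ∈ (weakPartial Ω (0, 1)).graph) : dy u = w :=
  LinearPMap.mem_graph_snd_inj _ (LinearPMap.mem_graph _ _) h rfl

/-- `g` is the Sobolev trace of `u ∈ H¹(Ω)` on the boundary piece that carries the measure `ν`.
The trace operator is the extension by continuity of the restriction map
`φ ↦ φ|_{∂Ω}`, `φ ∈ C_c^∞(ℝ²)`, from the `H¹(Ω)` norm to the `L²(ν)` norm. -/
def HasTrace {Ω : Set (ℝ × ℝ)} (ν : Measure (ℝ × ℝ)) (u : H1 Ω) (g : ℝ × ℝ → ℂ) : Prop :=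
  ∃ φ : ℕ → ℝ × ℝ → ℂ,
    (∀ n, ContDiff ℝ ∞ (φ n) ∧ HasCompactSupport (φ n)) ∧
    Tendsto (fun n => eLpNorm (fun p => φ n p - (u : L2 Ω) p) 2 (volume.restrict Ω))
      atTop (𝓝 0) ∧
    Tendsto (fun n => eLpNorm (fun p => fderiv ℝ (φ n) p (1, 0) - dx u p) 2 (volume.restrict Ω))
      atTop (𝓝 0) ∧
    Tendsto (fun n => eLpNorm (fun p => fderiv ℝ (φ n) p (0, 1) - dy u p) 2 (volume.restrict Ω))
      atTop (𝓝 0) ∧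
    Tendsto (fun n => eLpNorm (fun p => φ n p - g p) 2 ν) atTop (𝓝 0)

/-- Functions in `H¹(Ω)` with vanishing trace. -/
def H1Zero (Ω : Set (ℝ × ℝ)) (ν : Measure (ℝ × ℝ)) : Submodule ℂ (H1 Ω) where
  carrier := {u | HasTrace ν u 0}
  zero_mem' := by
    have h0 : ∀ w : L2 Ω, w = 0 → eLpNorm (fun p => (0 : ℂ) - w p) 2 (volume.restrict Ω) = 0 := by
      rintro w rfl
      rw [eLpNorm_congr_ae (g := fun _ => (0 : ℂ))
        ((Lp.coeFn_zero ℂ 2 _).mono fun p hp => by simp only [hp, Pi.zero_apply, sub_zero])]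
      simp
    refine ⟨fun _ _ => 0, fun _ => ⟨contDiff_const, HasCompactSupport.zero⟩, ?_, ?_, ?_, ?_⟩
    · simpa only [h0 ((0 : H1 Ω) : L2 Ω) rfl] using tendsto_const_nhds
    · simpa only [fderiv_fun_const, Pi.zero_apply, _root_.zero_apply,
        h0 _ (map_zero dx)] using tendsto_const_nhds
    · simpa only [fderiv_fun_const, Pi.zero_apply, _root_.zero_apply,
        h0 _ (map_zero dy)] using tendsto_const_nhds
    · simp
  add_mem' := by
    rintro u v ⟨φ, hφ, h1, h2, h3, h4⟩ ⟨ψ, hψ, k1, k2, k3, k4⟩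
    have key : ∀ (a b : L2 Ω) (f g : ℕ → ℝ × ℝ → ℂ), (∀ n, Continuous (f n)) →
        (∀ n, Continuous (g n)) →
        Tendsto (fun n => eLpNorm (fun p => f n p - a p) 2 (volume.restrict Ω)) atTop (𝓝 0) →
        Tendsto (fun n => eLpNorm (fun p => g n p - b p) 2 (volume.restrict Ω)) atTop (𝓝 0) →
        Tendsto (fun n => eLpNorm (fun p => (f n p + g n p) - (a + b) p) 2 (volume.restrict Ω))
          atTop (𝓝 0) := by
      intro a b f g hf hg ha hb
      have hab := ha.add hb
      rw [add_zero] at hab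
      refine tendsto_of_tendsto_of_tendsto_of_le_of_le tendsto_const_nhds hab
        (fun _ => zero_le) fun n => ?_
      rw [eLpNorm_congr_ae (g := (fun p => f n p - a p) + fun p => g n p - b p)
        ((Lp.coeFn_add a b).mono fun p hp => by
          simp only [hp, Pi.add_apply]; ring)]
      exact eLpNorm_add_le ((hf n).aestronglyMeasurable.sub (Lp.aestronglyMeasurable a))
        ((hg n).aestronglyMeasurable.sub (Lp.aestronglyMeasurable b)) (by norm_num)
    have hfd : ∀ n p e, fderiv ℝ (fun q => φ n q + ψ n q) p e
        = fderiv ℝ (φ n) p e + fderiv ℝ (ψ n) p e := by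
      intro n p e
      rw [fderiv_fun_add ((hφ n).1.differentiable (by simp) p)
        ((hψ n).1.differentiable (by simp) p)]
      rfl
    refine ⟨fun n p => φ n p + ψ n p, fun n => ⟨(hφ n).1.add (hψ n).1, (hφ n).2.add (hψ n).2⟩,
      ?_, ?_, ?_, ?_⟩
    · exact key _ _ _ _ (fun n => (hφ n).1.continuous) (fun n => (hψ n).1.continuous) h1 k1
    · simp only [hfd, map_add]
      exact key _ _ _ _ (fun n => continuous_partial (hφ n).1 _)
        (fun n => continuous_partial (hψ n).1 _) h2 k2
    · simp only [hfd, map_add]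
      exact key _ _ _ _ (fun n => continuous_partial (hφ n).1 _)
        (fun n => continuous_partial (hψ n).1 _) h3 k3
    · have hab := h4.add k4
      rw [add_zero] at hab
      refine tendsto_of_tendsto_of_tendsto_of_le_of_le tendsto_const_nhds hab
        (fun _ => zero_le) fun n => ?_
      simp only [Pi.zero_apply, sub_zero]
      exact eLpNorm_add_le (hφ n).1.continuous.aestronglyMeasurable
        (hψ n).1.continuous.aestronglyMeasurable (by norm_num)
  smul_mem' := by
    rintro c u ⟨φ, hφ, h1, h2, h3, h4⟩
    have key : ∀ (a : L2 Ω) (f : ℕ → ℝ × ℝ → ℂ),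
        Tendsto (fun n => eLpNorm (fun p => f n p - a p) 2 (volume.restrict Ω)) atTop (𝓝 0) →
        Tendsto (fun n => eLpNorm (fun p => c * f n p - (c • a) p) 2 (volume.restrict Ω))
          atTop (𝓝 0) := by
      intro a f ha
      have hc := ENNReal.Tendsto.const_mul (a := ‖c‖ₑ) ha (Or.inr enorm_ne_top)
      rw [mul_zero] at hc
      refine hc.congr fun n => ?_
      rw [← eLpNorm_const_smul]
      exact eLpNorm_congr_ae ((Lp.coeFn_smul c a).mono fun p hp => by
        simp only [hp, Pi.smul_apply, smul_eq_mul]; ring)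
    have hfd : ∀ n p e, fderiv ℝ (fun q => c * φ n q) p e = c * fderiv ℝ (φ n) p e := by
      intro n p e
      rw [fderiv_const_mul ((hφ n).1.differentiable (by simp) p)]
      rfl
    refine ⟨fun n p => c * φ n p, fun n => ⟨contDiff_const.mul (hφ n).1, (hφ n).2.mul_left⟩,
      ?_, ?_, ?_, ?_⟩
    · exact key _ _ h1
    · simp only [hfd, map_smul]
      exact key _ _ h2
    · simp only [hfd, map_smul]
      exact key _ _ h3
    · have hc := ENNReal.Tendsto.const_mul (a := ‖c‖ₑ) h4 (Or.inr enorm_ne_top)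
      rw [mul_zero] at hc
      refine hc.congr fun n => ?_
      rw [← eLpNorm_const_smul]
      simp [Pi.smul_def]

/-! ### Self-adjoint operators from forms, spectra -/

section Operators

variable {H : Type*} [NormedAddCommGroup H] [InnerProductSpace ℂ H]

/-- The graph `{(u, f) : u ∈ D, q(v, u) = ⟪v, f⟫ for all v ∈ D}` of the operator associated with
a sesquilinear form `q` with domain `D`. -/
def formOperatorGraph (D : Submodule ℂ H) (q : D →ₗ⋆[ℂ] D →ₗ[ℂ] ℂ) : Submodule ℂ (H × H) where
  carrier := {p | ∃ h : p.1 ∈ D, ∀ v : D, q v ⟨p.1, h⟩ = inner ℂ (v : H) p.2}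
  zero_mem' := ⟨D.zero_mem, fun v => by
    rw [show (⟨(0 : H × H).1, D.zero_mem⟩ : D) = 0 from rfl]; simp⟩
  add_mem' := by
    rintro a b ⟨ha, ha'⟩ ⟨hb, hb'⟩
    refine ⟨D.add_mem ha hb, fun v => ?_⟩
    rw [show (⟨(a + b).1, D.add_mem ha hb⟩ : D) = ⟨a.1, ha⟩ + ⟨b.1, hb⟩ from rfl, map_add, ha', hb',
      Prod.snd_add, inner_add_right]
  smul_mem' := by
    rintro c a ⟨ha, ha'⟩
    refine ⟨D.smul_mem c ha, fun v => ?_⟩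
    rw [show (⟨(c • a).1, D.smul_mem c ha⟩ : D) = c • ⟨a.1, ha⟩ from rfl, map_smul, ha',
      Prod.smul_snd, inner_smul_right, smul_eq_mul]

/-- The operator associated with a densely defined sesquilinear form. -/
def formOperator (D : Submodule ℂ H) (q : D →ₗ⋆[ℂ] D →ₗ[ℂ] ℂ) : H →ₗ.[ℂ] H :=
  (formOperatorGraph D q).toLinearPMap

lemma formOperator_graph (D : Submodule ℂ H) (q : D →ₗ⋆[ℂ] D →ₗ[ℂ] ℂ)
    (hD : Dense (D : Set H)) : (formOperator D q).graph = formOperatorGraph D q := by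
  refine Submodule.toLinearPMap_graph_eq _ ?_
  rintro ⟨u, f⟩ ⟨hu, h⟩ (rfl : u = 0)
  refine hD.eq_zero_of_inner_right ℂ fun v hv => ?_
  rw [← h ⟨v, hv⟩]
  rw [show (⟨((0 : H), f).1, hu⟩ : D) = 0 from rfl, map_zero]

/-- The resolvent set: `T - z` is a bijection from the domain of `T` onto `H` with bounded
inverse `R`. -/
def resolventSet (T : H →ₗ.[ℂ] H) : Set ℂ :=
  {z | ∃ R : H →L[ℂ] H,
    (∀ f : H, ∃ h : R f ∈ T.domain, T ⟨R f, h⟩ - z • R f = f) ∧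
    ∀ u : T.domain, R (T u - z • (u : H)) = u}

/-- The spectrum of an unbounded operator. -/
def spectrum (T : H →ₗ.[ℂ] H) : Set ℂ := (resolventSet T)ᶜ

/-- The eigenspace `ker (T - z)`. -/
def eigenspace (T : H →ₗ.[ℂ] H) (z : ℂ) : Submodule ℂ H :=
  (LinearMap.ker (T.toFun - z • T.domain.subtype)).map T.domain.subtype

/-- The discrete spectrum: eigenvalues of finite multiplicity that are isolated points of the
spectrum. -/
def discreteSpectrum (T : H →ₗ.[ℂ] H) : Set ℂ :=
  {z | eigenspace T z ≠ ⊥ ∧ FiniteDimensional ℂ (eigenspace T z) ∧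
    ¬ AccPt z (𝓟 (spectrum T))}

end Operators

/-! ### The pencil-shaped domain -/

/-- The pencil-shaped domain `Ω = {(x, y) ∈ [0,∞)² : |x - y| ≤ d}`. -/
def pencil (d : ℝ) : Set (ℝ × ℝ) := {p | 0 ≤ p.1 ∧ 0 ≤ p.2 ∧ |p.1 - p.2| ≤ d}

/-- The length measure (normalised by the parameter `t`, that is, arc length divided by `√2`) on
the part `{(x, y) ∈ [0,∞)² : |x - y| = d}` of the boundary of the pencil, which consists of the
two half-lines `(t + d, t)` and `(t, t + d)`, `t ≥ 0`. -/
def wallMeasure (d : ℝ) : Measure (ℝ × ℝ) :=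
  (volume.restrict (Set.Ici (0 : ℝ))).map (fun t => (t + d, t)) +
    (volume.restrict (Set.Ici (0 : ℝ))).map (fun t => (t, t + d))

/-- The form domain: functions in `H¹(Ω)` with zero trace on `|x - y| = d`. -/
def formDomain (d : ℝ) : Submodule ℂ (L2 (pencil d)) :=
  (H1Zero (pencil d) (wallMeasure d)).map (H1 (pencil d)).subtype

lemma formDomain_le (d : ℝ) : formDomain d ≤ H1 (pencil d) := Submodule.map_subtype_le _ _

/-- The sesquilinear form `q(u, v) = ∫_Ω ∇u̅ · ∇v`, for vanishing boundary and contact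
potentials. -/
def form (d : ℝ) : formDomain d →ₗ⋆[ℂ] formDomain d →ₗ[ℂ] ℂ :=
  let ι := Submodule.inclusion (formDomain_le d)
  LinearMap.mk₂'ₛₗ (starRingEnd ℂ) (RingHom.id ℂ)
    (fun u v => inner ℂ (dx (ι u)) (dx (ι v)) + inner ℂ (dy (ι u)) (dy (ι v)))
    (fun u v w => by simp only [map_add, inner_add_left]; ring)
    (fun c u v => by simp only [map_smul, inner_smul_left, smul_eq_mul]; ring)
    (fun u v w => by simp only [map_add, inner_add_right]; ring)
    (fun c u v => by simp only [map_smul, inner_smul_right, smul_eq_mul, RingHom.id_apply]; ring)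

/-- The Laplacian `-Δ` on the pencil with Dirichlet conditions on `|x - y| = d` and Neumann
conditions on the rest of the boundary: the operator associated with the form. -/
def pencilLaplacian (d : ℝ) : L2 (pencil d) →ₗ.[ℂ] L2 (pencil d) :=
  formOperator (formDomain d) (form d)

/-! ### The operator is well defined -/

lemma volume_frontier_pencil (d : ℝ) : volume (frontier (pencil d)) = 0 := by
  refine Convex.addHaar_frontier volume ?_
  have h : pencil d = {p | 0 ≤ p.1} ∩ ({p | 0 ≤ p.2} ∩
      ((fun p : ℝ × ℝ => p.1 - p.2) ⁻¹' Set.Icc (-d) d)) := by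
    ext p
    simp [pencil, abs_le]
  rw [h]
  refine (convex_halfSpace_ge (LinearMap.fst ℝ ℝ ℝ).isLinear 0).inter
    ((convex_halfSpace_ge (LinearMap.snd ℝ ℝ ℝ).isLinear 0).inter ?_)
  exact (convex_Icc (-d) d).linear_preimage (LinearMap.fst ℝ ℝ ℝ - LinearMap.snd ℝ ℝ ℝ)

lemma abs_lt_of_mem_interior {d : ℝ} {p : ℝ × ℝ} (hp : p ∈ interior (pencil d)) :
    |p.1 - p.2| < d := by
  obtain ⟨ε, hε, hb⟩ := Metric.mem_nhds_iff.1 (mem_interior_iff_mem_nhds.1 hp)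
  have h1 : ((p.1 + ε / 2, p.2) : ℝ × ℝ) ∈ pencil d := hb (by
    simp [Prod.dist_eq, abs_of_pos hε, hε])
  have h2 : ((p.1, p.2 + ε / 2) : ℝ × ℝ) ∈ pencil d := hb (by
    simp [Prod.dist_eq, abs_of_pos hε, hε])
  have h3 := (abs_le.1 h1.2.2).2
  have h4 := (abs_le.1 h2.2.2).1
  simp only at h3 h4
  rw [abs_lt]
  constructor <;> linarith

lemma toLp_mem_weakPartialGraph {Ω : Set (ℝ × ℝ)} {ψ : ℝ × ℝ → ℂ} (hψ : IsTestFunction Ω ψ)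
    (e : ℝ × ℝ) :
    (hψ.memLp.toLp, (hψ.memLp_partial e).toLp) ∈ weakPartialGraph Ω e := by
  intro φ hφ
  have aux : ∀ f g : ℝ × ℝ → ℂ, tsupport f ⊆ interior Ω →
      ∫ p in Ω, f p * g p = ∫ p, f p * g p := by
    intro f g hf
    refine setIntegral_eq_integral_of_forall_compl_eq_zero fun p hp => ?_
    rw [image_eq_zero_of_notMem_tsupport fun h => hp (interior_subset (hf h)), zero_mul]
  have i1 : ∫ p in Ω, (hψ.memLp.toLp : L2 Ω) p * fderiv ℝ φ p e
      = ∫ p in Ω, ψ p * fderiv ℝ φ p e :=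
    integral_congr_ae (hψ.memLp.coeFn_toLp.mono fun p hp => by simp only [hp])
  have i2 : ∫ p in Ω, ((hψ.memLp_partial e).toLp : L2 Ω) p * φ p
      = ∫ p in Ω, fderiv ℝ ψ p e * φ p :=
    integral_congr_ae ((hψ.memLp_partial e).coeFn_toLp.mono fun p hp => by simp only [hp])
  rw [i1, i2, aux _ _ hψ.2.2, aux _ _ ((tsupport_fderiv_apply_subset ℝ e).trans hψ.2.2)]
  have c1 := hψ.1.continuous
  have c2 := hφ.1.continuous
  have c3 := continuous_partial hψ.1 e
  have c4 := continuous_partial hφ.1 e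
  exact integral_mul_fderiv_eq_neg_fderiv_mul_of_integrable
    ((c3.mul c2).integrable_of_hasCompactSupport hφ.2.1.mul_left)
    ((c1.mul c4).integrable_of_hasCompactSupport hψ.2.1.mul_right)
    ((c1.mul c2).integrable_of_hasCompactSupport hψ.2.1.mul_right)
    (fun p _ => hψ.1.differentiable (by simp) p) (fun p _ => hφ.1.differentiable (by simp) p)

lemma toLp_mem_formDomain {d : ℝ} {ψ : ℝ × ℝ → ℂ} (hψ : IsTestFunction (pencil d) ψ) :
    (hψ.memLp.toLp : L2 (pencil d)) ∈ formDomain d := by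
  have hg : ∀ e, (hψ.memLp.toLp, (hψ.memLp_partial e).toLp) ∈ (weakPartial (pencil d) e).graph :=
    fun e => by
      rw [weakPartial_graph (volume_frontier_pencil d)]
      exact toLp_mem_weakPartialGraph hψ e
  have m : (hψ.memLp.toLp : L2 (pencil d)) ∈ H1 (pencil d) :=
    Submodule.mem_inf.2 ⟨LinearPMap.mem_domain_iff.2 ⟨_, hg (1, 0)⟩,
      LinearPMap.mem_domain_iff.2 ⟨_, hg (0, 1)⟩⟩
  have e1 : dx (⟨_, m⟩ : H1 (pencil d)) = (hψ.memLp_partial (1, 0)).toLp := dx_eq (hg (1, 0))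
  have e2 : dy (⟨_, m⟩ : H1 (pencil d)) = (hψ.memLp_partial (0, 1)).toLp := dy_eq (hg (0, 1))
  have key : ∀ (f : ℝ × ℝ → ℂ) (hf : MemLp f 2 (volume.restrict (pencil d))),
      Tendsto (fun _ : ℕ => eLpNorm (fun p => f p - (hf.toLp : L2 (pencil d)) p) 2
        (volume.restrict (pencil d))) atTop (𝓝 0) := by
    intro f hf
    have : eLpNorm (fun p => f p - (hf.toLp : L2 (pencil d)) p) 2
        (volume.restrict (pencil d)) = 0 := by
      rw [eLpNorm_congr_ae (g := fun _ => (0 : ℂ))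
        (hf.coeFn_toLp.mono fun p hp => by simp only [hp, sub_self])]
      simp
    rw [this]
    exact tendsto_const_nhds
  have hwall : ∀ p : ℝ × ℝ, |p.1 - p.2| = |d| → ψ p = 0 := fun p hp =>
    image_eq_zero_of_notMem_tsupport fun h => by
      have := abs_lt_of_mem_interior (hψ.2.2 h)
      rw [hp] at this
      exact absurd this (not_lt.2 (le_abs_self d))
  refine Submodule.mem_map.2 ⟨⟨_, m⟩, ⟨fun _ => ψ, fun _ => ⟨hψ.1, hψ.2.1⟩, key _ hψ.memLp, ?_, ?_, ?_⟩,
    rfl⟩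
  · rw [e1]
    exact key _ (hψ.memLp_partial _)
  · rw [e2]
    exact key _ (hψ.memLp_partial _)
  · have h0 : eLpNorm (fun p => ψ p - (0 : ℝ × ℝ → ℂ) p) 2 (wallMeasure d) = 0 := by
      have hm : Measurable ψ := hψ.1.continuous.measurable
      rw [eLpNorm_congr_ae (g := fun _ => (0 : ℂ))]
      · simp
      have hS : MeasurableSet {p : ℝ × ℝ | ψ p - (0 : ℝ × ℝ → ℂ) p = 0} :=
        measurableSet_eq_fun (hm.sub measurable_const) measurable_const
      refine ae_add_measure_iff.2 ⟨?_, ?_⟩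
      · refine (ae_map_iff (by fun_prop) hS).2 (ae_of_all _ fun t => ?_)
        simp [hwall]
      · refine (ae_map_iff (by fun_prop) hS).2 (ae_of_all _ fun t => ?_)
        simp [hwall]
    exact Tendsto.congr (fun _ => h0.symm) tendsto_const_nhds

lemma dense_formDomain (d : ℝ) : Dense (formDomain d : Set (L2 (pencil d))) := by
  rw [Submodule.dense_iff_topologicalClosure_eq_top, Submodule.topologicalClosure_eq_top_iff,
    Submodule.eq_bot_iff]
  intro w hw
  refine eq_zero_of_forall_test (volume_frontier_pencil d) w fun φ hφ => ?_
  have hφ' : IsTestFunction (pencil d) (fun p => star (φ p)) :=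
    ⟨(starL' ℝ : ℂ ≃L[ℝ] ℂ).contDiff.comp hφ.1, hφ.2.1.comp_left (star_zero ℂ),
      (closure_mono fun p hp => by
        simp only [Function.mem_support, ne_eq, star_eq_zero] at hp ⊢
        exact hp).trans hφ.2.2⟩
  have h := (Submodule.mem_orthogonal _ w).1 hw _ (toLp_mem_formDomain hφ')
  rw [L2.inner_def] at h
  rw [← h]
  refine integral_congr_ae (hφ'.memLp.coeFn_toLp.mono fun p hp => ?_)
  simp only [hp, RCLike.inner_apply]
  simp

/-- `(u, f)` is in the graph of `-Δ` iff `u` is in the form domain and `q(v, u) = ⟪v, f⟫` for all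
`v` in the form domain. -/
lemma pencilLaplacian_graph (d : ℝ) :
    (pencilLaplacian d).graph = formOperatorGraph (formDomain d) (form d) :=
  formOperator_graph _ _ (dense_formDomain d)

end PencilSpectrum

end

/-!
Let `Λ = π² / (2d²)`, the bottom of the transverse spectrum of the strip `|x - y| ≤ d`.

The form `q` is closed because the weak derivatives are closed and vanishing trace survives limits
in the `H¹` norm (`isClosed_hilbertGraph_gradient`). Hence `T = -Δ` has a bounded positive inverse
`R = (T + 1)⁻¹`, the compression to `L²(Ω)` of the projection onto the graph of the gradient
(`exists_isInverseAddOne`), and self-adjointness of `T` is read off from that of `R`.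

Instead of locating the essential spectrum, one shows that a single linear condition removes
everything below `Λ`: if `u` in the form domain has mean zero over the corner square
`Q = [0, d]² ⊆ Ω`, then `q(u) ≥ Λ ‖u‖²` (`le_norm_gradient_sq`). On `Q` this is Wirtinger's
inequality, whose constant `π² / d²` exceeds `Λ`. The remainder of `Ω` is sliced by the lines
`x + y = s`. The slices on either side of the diagonal are segments of transverse length at most
half the width of the strip, with one end on a wall, so Friedrichs' inequality with a Dirichlet and
a Neumann end gives `Λ`. The inequalities are proved for smooth functions with an error term on the
walls, which disappears in the limit.

For `R` the linear condition says that `‖R f‖ ≤ ‖f‖ / (1 + Λ)` on a hyperplane. So `R` is a rank-one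
perturbation of an operator of norm at most `1 / (1 + Λ)`. By the Fredholm alternative the
spectrum of `R` outside the disc of that radius consists of eigenvalues, and since two orthogonal
eigenvectors would have a combination in the hyperplane, of at most one, which is simple
(`IsInverseAddOne.exists_mem_discreteSpectrum`).

There is one as soon as `q(u) < Λ ‖u‖²` for some `u`. Take `cos (π (x - y) / 2d)` with a cutoff at
a large distance `r`. A full transverse slice contributes nothing to `q - Λ ‖·‖²`, the truncated
slices with `x + y < d` contribute `-1` in total, and the cutoff `O(1 / r)`
(`exists_norm_gradient_sq_lt`).
-/

noncomputable section

namespace PencilSpectrum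

/-! ### Bounded operators that are small on a hyperplane -/

section BoundedOperator

variable {H : Type*} [NormedAddCommGroup H] [InnerProductSpace ℂ H]

/-- Outside the disc of radius `c` the spectrum of an operator bounded by `c` on the hyperplane
`eᗮ` consists of eigenvalues: up to an invertible factor, `μ - R` is a rank-one perturbation of the
identity, to which the Fredholm alternative applies. -/
lemma exists_eigenvector_of_mem_spectrum [CompleteSpace H] {R : H →L[ℂ] H} {e : H} {c : ℝ}
    (hc : 0 ≤ c) (hR : ∀ u, inner ℂ e u = 0 → ‖R u‖ ≤ c * ‖u‖) {μ : ℂ} (hμ : c < ‖μ‖)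
    (h : μ ∈ _root_.spectrum ℂ R) : ∃ v : H, v ≠ 0 ∧ R v = μ • v := by
  set S : Submodule ℂ H := ℂ ∙ e
  set P : H →L[ℂ] H := S.starProjection with hP
  set A : H →L[ℂ] H := R * (1 - P) with hA
  have hA_norm : ‖A‖ ≤ c := by
    refine A.opNorm_le_bound hc fun u => ?_
    have h1 : (1 - P) u = Sᗮ.starProjection u := by
      simp [hP, Submodule.starProjection_orthogonal]
    have h2 : inner ℂ e ((1 - P) u) = 0 := by
      rw [h1]
      exact Submodule.inner_right_of_mem_orthogonal (Submodule.mem_span_singleton_self e)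
        (Submodule.starProjection_apply_mem _ _)
    calc ‖A u‖ = ‖R ((1 - P) u)‖ := rfl
      _ ≤ c * ‖(1 - P) u‖ := hR _ h2
      _ ≤ c * ‖u‖ := by
        gcongr
        rw [h1]
        exact Submodule.norm_starProjection_apply_le _ _
  rcases subsingleton_or_nontrivial H with hH | hH
  · simp [_root_.spectrum.of_subsingleton] at h
  obtain ⟨B, hB⟩ : IsUnit (algebraMap ℂ (H →L[ℂ] H) μ - A) :=
    _root_.spectrum.mem_resolventSet_iff.1
      (_root_.spectrum.mem_resolventSet_of_norm_lt (lt_of_le_of_lt hA_norm hμ))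
  set F : H →L[ℂ] H := ↑B⁻¹ * (R * P) with hF
  have hBF : (B : H →L[ℂ] H) * F = R * P := by
    rw [hF, ← mul_assoc, Units.mul_inv, one_mul]
  have hdecomp : algebraMap ℂ (H →L[ℂ] H) μ - R = B * (1 - F) := by
    rw [mul_sub, hBF, hB, hA]
    noncomm_ring
  have hPc : IsCompactOperator P :=
    (isCompactOperator_of_locallyCompactSpace_dom S.orthogonalProjectionOnto).clm_comp S.subtypeL
  have hFc : IsCompactOperator F := (hPc.clm_comp R).clm_comp (↑B⁻¹ : H →L[ℂ] H)
  rcases hFc.hasEigenvalue_or_mem_resolventSet (one_ne_zero (α := ℂ)) with h1 | h1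
  · obtain ⟨v, hv⟩ := h1.exists_hasEigenvector
    refine ⟨v, hv.2, ?_⟩
    have h2 : F v = v := by simpa using hv.apply_eq_smul
    have h3 := congrArg (fun T : H →L[ℂ] H => T v) hdecomp
    have h4 : (1 - F) v = 0 := by simp [h2]
    simp only [mul_apply_eq_comp, h4, map_zero] at h3
    have h5 : μ • v - R v = 0 := by simpa [Algebra.algebraMap_eq_smul_one] using h3
    exact (sub_eq_zero.1 h5).symm
  · exfalso
    refine h (_root_.spectrum.mem_resolventSet_iff.2 ?_)
    rw [hdecomp]
    exact B.isUnit.mul (by simpa using _root_.spectrum.mem_resolventSet_iff.1 h1)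

/-- Above the threshold `c` there is room for one eigenvector only: a combination of two
orthogonal ones would be orthogonal to `e`. -/
lemma eq_zero_of_orthogonal_eigenvectors {R : H →L[ℂ] H} {e : H} {c : ℝ} (hc : 0 ≤ c)
    (hR : ∀ u, inner ℂ e u = 0 → ‖R u‖ ≤ c * ‖u‖) {μ ν : ℂ} (hμ : c < ‖μ‖) (hν : c < ‖ν‖)
    {v w : H} (hv : R v = μ • v) (hw : R w = ν • w) (hvw : inner ℂ v w = 0) :
    v = 0 ∨ w = 0 := by
  have key : ∀ {μ : ℂ} {v : H}, c < ‖μ‖ → R v = μ • v → inner ℂ e v = 0 → v = 0 := by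
    intro μ v hμ hv hev
    have h1 := hR v hev
    rw [hv, norm_smul] at h1
    by_contra hne
    have := norm_pos_iff.2 hne
    nlinarith
  by_contra! hne
  obtain ⟨hv0, hw0⟩ := hne
  -- the combination of `v` and `w` that is orthogonal to `e`
  set α : ℂ := inner ℂ e w with hα
  set β : ℂ := - inner ℂ e v with hβ
  have hβ0 : β ≠ 0 := fun h => hv0 (key hμ hv (neg_eq_zero.1 h))
  have h1 : inner ℂ e (α • v + β • w) = 0 := by
    rw [inner_add_right, inner_smul_right, inner_smul_right, hα, hβ]; ring
  have h2 := hR _ h1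
  have h3 : ∀ a b : ℂ, ‖a • v + b • w‖ ^ 2 = ‖a‖ ^ 2 * ‖v‖ ^ 2 + ‖b‖ ^ 2 * ‖w‖ ^ 2 := by
    intro a b
    rw [sq, norm_add_sq_eq_norm_sq_add_norm_sq_of_inner_eq_zero (𝕜 := ℂ) (a • v) (b • w)
      (by rw [inner_smul_left, inner_smul_right, hvw]; simp), norm_smul, norm_smul]
    ring
  have h4 : ‖R (α • v + β • w)‖ ^ 2 ≤ c ^ 2 * ‖α • v + β • w‖ ^ 2 := by
    rw [← mul_pow]
    gcongr
  rw [map_add, map_smul, map_smul, hv, hw, smul_smul, smul_smul, h3, h3, norm_mul, norm_mul] at h4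
  have h5 : 0 < ‖β‖ ^ 2 * ‖w‖ ^ 2 := by
    have := norm_pos_iff.2 hβ0
    have := norm_pos_iff.2 hw0
    positivity
  have h6 : 0 ≤ ‖α‖ ^ 2 * ‖v‖ ^ 2 := by positivity
  have h7 : c ^ 2 < ‖μ‖ ^ 2 := by gcongr
  have h8 : c ^ 2 < ‖ν‖ ^ 2 := by gcongr
  nlinarith

end BoundedOperator

/-! ### Operators with a bounded inverse of `T + 1` -/

section Resolvent

variable {H : Type*} [NormedAddCommGroup H] [InnerProductSpace ℂ H]

/-- `R` is the inverse of `T + 1`, expressed through the graph of `T`. -/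
def IsInverseAddOne (T : H →ₗ.[ℂ] H) (R : H →L[ℂ] H) : Prop :=
  ∀ u f : H, (u, f) ∈ T.graph ↔ R (f + u) = u

lemma IsInverseAddOne.apply_mem {T : H →ₗ.[ℂ] H} {R : H →L[ℂ] H} (h : IsInverseAddOne T R)
    (g : H) : (R g, g - R g) ∈ T.graph := by
  rw [h]; simp

/-- The graph of `T` is `{(R g, g - R g)}`, and for self-adjoint `R` the adjoint of this relation is
the relation itself. -/
lemma IsInverseAddOne.isSelfAdjoint [CompleteSpace H] {T : H →ₗ.[ℂ] H} {R : H →L[ℂ] H}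
    (h : IsInverseAddOne T R) (hR : IsSelfAdjoint R) : IsSelfAdjoint T := by
  have hsym : ∀ x y, inner ℂ (R x) y = inner ℂ x (R y) := fun x y =>
    hR.isSymmetric x y
  have hdense : Dense (T.domain : Set H) := by
    rw [Submodule.dense_iff_topologicalClosure_eq_top, Submodule.topologicalClosure_eq_top_iff,
      Submodule.eq_bot_iff]
    intro y hy
    have h1 : R y = 0 := by
      refine ext_inner_left ℂ fun x => ?_
      rw [← hsym, inner_zero_right]
      exact (Submodule.mem_orthogonal _ _).1 hy _
        (LinearPMap.mem_domain_of_mem_graph (h.apply_mem x))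
    have h2 := h.apply_mem y
    rw [h1] at h2
    simpa using LinearPMap.graph_fst_eq_zero_snd _ h2 rfl
  rw [LinearPMap.isSelfAdjoint_def]
  refine LinearPMap.eq_of_eq_graph ?_
  rw [LinearPMap.adjoint_graph_eq_graph_adjoint hdense]
  ext ⟨y, f⟩
  rw [Submodule.mem_adjoint_iff, h]
  constructor
  · intro h1
    refine ext_inner_left ℂ fun x => ?_
    have h2 := h1 _ _ (h.apply_mem x)
    simp only [inner_sub_left, hsym] at h2
    rw [map_add, inner_add_right]
    linear_combination -h2
  · intro h1 a b hab
    rw [h] at hab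
    simp only
    have h2 : inner ℂ (R (b + a)) (f + y) = inner ℂ (b + a) (R (f + y)) := hsym _ _
    rw [h1, hab, inner_add_right, inner_add_left] at h2
    linear_combination -h2

/-- From `T - z = (1 - (1 + z) R) (T + 1)`. -/
lemma IsInverseAddOne.mem_resolventSet [CompleteSpace H] {T : H →ₗ.[ℂ] H} {R : H →L[ℂ] H}
    (h : IsInverseAddOne T R) {z : ℂ} (hz : 1 + z ≠ 0)
    (hu : (1 + z)⁻¹ ∉ _root_.spectrum ℂ R) : z ∈ resolventSet T := by
  obtain ⟨B, hB⟩ : IsUnit (1 - (1 + z) • R) := by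
    have h1 := _root_.spectrum.notMem_iff.1 hu
    have h2 : 1 - (1 + z) • R = (1 + z) • (algebraMap ℂ (H →L[ℂ] H) (1 + z)⁻¹ - R) := by
      rw [smul_sub, Algebra.algebraMap_eq_smul_one, smul_smul, mul_inv_cancel₀ hz, one_smul]
    rw [h2]
    exact h1.smul (Units.mk0 _ hz)
  have hB1 : ∀ f, (↑B⁻¹ : H →L[ℂ] H) f - (1 + z) • R ((↑B⁻¹ : H →L[ℂ] H) f) = f := by
    intro f
    have := congrArg (fun T : H →L[ℂ] H => T f) B.mul_inv
    rw [hB] at this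
    simpa using this
  have hB2 : ∀ f, (↑B⁻¹ : H →L[ℂ] H) (f - (1 + z) • R f) = f := by
    intro f
    have := congrArg (fun T : H →L[ℂ] H => T f) B.inv_mul
    rw [hB] at this
    simpa using this
  refine ⟨R * ↑B⁻¹, fun f => ?_, fun u => ?_⟩
  · have h1 := h.apply_mem ((↑B⁻¹ : H →L[ℂ] H) f)
    refine ⟨LinearPMap.mem_domain_of_mem_graph h1, ?_⟩
    have h2 : T ⟨R ((↑B⁻¹ : H →L[ℂ] H) f), LinearPMap.mem_domain_of_mem_graph h1⟩ = _ :=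
      LinearPMap.mem_graph_snd_inj _ (LinearPMap.mem_graph _ _) h1 rfl
    change T ⟨R ((↑B⁻¹ : H →L[ℂ] H) f), _⟩ - z • R ((↑B⁻¹ : H →L[ℂ] H) f) = f
    rw [h2]
    conv_rhs => rw [← hB1 f]
    rw [add_smul, one_smul]
    abel
  · have h1 := (h _ _).1 (LinearPMap.mem_graph T u)
    have h2 : T u - z • (u : H) = (T u + u) - (1 + z) • R (T u + u) := by
      rw [h1, add_smul, one_smul]; abel
    rw [h2]
    change R ((↑B⁻¹ : H →L[ℂ] H) _) = _
    rw [hB2, h1]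

lemma IsInverseAddOne.mem_eigenspace {T : H →ₗ.[ℂ] H} {R : H →L[ℂ] H}
    (h : IsInverseAddOne T R) {z : ℂ} (hz : 1 + z ≠ 0) (u : H) :
    u ∈ eigenspace T z ↔ R u = (1 + z)⁻¹ • u := by
  have h1 : u ∈ eigenspace T z ↔ (u, z • u) ∈ T.graph := by
    rw [eigenspace, Submodule.mem_map, LinearPMap.mem_graph_iff]
    constructor
    · rintro ⟨y, hy, rfl⟩
      exact ⟨y, rfl, by simpa [sub_eq_zero] using hy⟩
    · rintro ⟨y, rfl, hy⟩
      exact ⟨y, by simpa [sub_eq_zero] using hy, rfl⟩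
  rw [h1, h, show z • u + u = (1 + z) • u by rw [add_smul, one_smul, add_comm], map_smul]
  constructor
  · intro h2
    conv_rhs => rw [← h2]
    rw [smul_smul, inv_mul_cancel₀ hz, one_smul]
  · intro h2
    rw [h2, smul_smul, mul_inv_cancel₀ hz, one_smul]

/-- If `R` has norm above `(1 + Λ)⁻¹` but is bounded by `(1 + Λ)⁻¹` on a hyperplane, its norm is a
simple eigenvalue, and the rest of its spectrum lies in the disc of radius `(1 + Λ)⁻¹`. -/
lemma IsInverseAddOne.exists_mem_discreteSpectrum [CompleteSpace H] {T : H →ₗ.[ℂ] H} {R : H →L[ℂ] H}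
    (h : IsInverseAddOne T R) (hpos : R.IsPositive) {e : H} {Λ : ℝ} (hΛ : 0 < 1 + Λ)
    (hR : ∀ u, inner ℂ e u = 0 → ‖R u‖ ≤ (1 + Λ)⁻¹ * ‖u‖) (hn : (1 + Λ)⁻¹ < ‖R‖) :
    ∃ E : ℝ, (E : ℂ) ∈ discreteSpectrum T ∧ E < Λ := by
  have hc : 0 < (1 + Λ)⁻¹ := inv_pos.2 hΛ
  set c := (1 + Λ)⁻¹ with hcdef
  have hm : 0 < ‖R‖ := hc.trans hn
  set m := ‖R‖ with hmdef
  have hsym : ∀ x y, inner ℂ (R x) y = inner ℂ x (R y) := fun x y =>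
    hpos.isSelfAdjoint.isSymmetric x y
  have hnt : Nontrivial (H →L[ℂ] H) := ⟨R, 0, norm_pos_iff.1 hm⟩
  have hspec : (m : ℂ) ∈ _root_.spectrum ℂ R := by
    have := CStarAlgebra.norm_mem_spectrum_of_nonneg (a := R)
      ((ContinuousLinearMap.nonneg_iff_isPositive R).2 hpos)
    exact _root_.spectrum.algebraMap_mem ℂ this
  have hmn : ‖(m : ℂ)‖ = m := by simp [hm.le]
  obtain ⟨w, hw0, hw⟩ := exists_eigenvector_of_mem_spectrum hc.le hR (hmn.symm ▸ hn) hspec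
  have hE : (1 : ℂ) + ((m⁻¹ - 1 : ℝ) : ℂ) = (m : ℂ)⁻¹ := by push_cast; ring
  have hmC : (m : ℂ) ≠ 0 := by exact_mod_cast hm.ne'
  have hE0 : (1 : ℂ) + ((m⁻¹ - 1 : ℝ) : ℂ) ≠ 0 := hE ▸ inv_ne_zero hmC
  refine ⟨m⁻¹ - 1, ⟨?_, ?_, ?_⟩, ?_⟩
  · rw [Submodule.ne_bot_iff]
    exact ⟨w, (h.mem_eigenspace hE0 w).2 (by rw [hE, inv_inv, hw]), hw0⟩
  · have hsub : eigenspace T ((m⁻¹ - 1 : ℝ) : ℂ) ≤ ℂ ∙ w := by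
      intro v hv
      rw [h.mem_eigenspace hE0, hE, inv_inv] at hv
      -- the part of `v` orthogonal to `w` is again in the eigenspace
      set a : ℂ := inner ℂ w v / inner ℂ w w with ha
      have hww : inner ℂ w w ≠ 0 := inner_self_ne_zero.2 hw0
      have h1 : R (v - a • w) = (m : ℂ) • (v - a • w) := by
        rw [map_sub, map_smul, hv, hw, smul_sub, smul_comm]
      have h2 : inner ℂ w (v - a • w) = 0 := by
        rw [inner_sub_right, inner_smul_right, ha, div_mul_cancel₀ _ hww, sub_self]
      rcases eq_zero_of_orthogonal_eigenvectors hc.le hR (hmn.symm ▸ hn) (hmn.symm ▸ hn) hw h1 h2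
        with h3 | h3
      · exact absurd h3 hw0
      · rw [sub_eq_zero.1 h3]
        exact Submodule.smul_mem _ _ (Submodule.mem_span_singleton_self w)
    exact Submodule.finiteDimensional_of_le hsub
  · rw [accPt_iff_frequently, not_frequently]
    have hcont : ContinuousAt (fun z : ℂ => ‖(1 + z)⁻¹‖) ((m⁻¹ - 1 : ℝ) : ℂ) :=
      ((continuousAt_const.add continuousAt_id).inv₀ hE0).norm
    have h1 : ∀ᶠ z in 𝓝 ((m⁻¹ - 1 : ℝ) : ℂ), c < ‖(1 + z)⁻¹‖ :=
      hcont.eventually_const_lt (by simp only [hE, inv_inv, hmn]; exact hn)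
    filter_upwards [h1] with z hz
    rintro ⟨hne, hzs⟩
    refine hzs (h.mem_resolventSet ?_ fun hsp => ?_)
    · intro h0
      rw [h0, inv_zero, norm_zero] at hz
      exact absurd hz (not_lt.2 hc.le)
    · obtain ⟨v, hv0, hv⟩ := exists_eigenvector_of_mem_spectrum hc.le hR hz hsp
      have h2 := hsym w v
      rw [hw, hv, inner_smul_left, inner_smul_right, Complex.conj_ofReal] at h2
      have h3 : ((m : ℂ) - (1 + z)⁻¹) * inner ℂ w v = 0 := by linear_combination h2
      rcases mul_eq_zero.1 h3 with h4 | h4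
      · apply hne
        have h5 : (1 + z) = (m : ℂ)⁻¹ := by rw [sub_eq_zero.1 h4, inv_inv]
        push_cast
        linear_combination h5
      · rcases eq_zero_of_orthogonal_eigenvectors hc.le hR (hmn.symm ▸ hn) hz hw hv h4 with h5 | h5
        · exact hw0 h5
        · exact hv0 h5
  · have h1 : m⁻¹ < c⁻¹ := (inv_lt_inv₀ hm hc).2 hn
    rw [hcdef, inv_inv] at h1
    linarith

end Resolvent

/-! ### Self-adjoint operators from closed forms -/

section Form

variable {H K : Type*} [NormedAddCommGroup H] [InnerProductSpace ℂ H]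
  [NormedAddCommGroup K] [InnerProductSpace ℂ K]

/-- The graph of `j : D → K` as a subspace of the Hilbert sum of `H` and `K`. -/
def hilbertGraph (D : Submodule ℂ H) (j : D →ₗ[ℂ] K) : Submodule ℂ (WithLp 2 (H × K)) :=
  LinearMap.range ((WithLp.linearEquiv 2 ℂ (H × K)).symm.toLinearMap ∘ₗ D.subtype.prod j)

lemma mem_hilbertGraph {D : Submodule ℂ H} {j : D →ₗ[ℂ] K} {x : WithLp 2 (H × K)} :
    x ∈ hilbertGraph D j ↔ ∃ u : D, (u : H) = x.fst ∧ j u = x.snd := by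
  rw [hilbertGraph, LinearMap.mem_range]
  refine exists_congr fun u => ⟨?_, ?_⟩
  · rintro rfl
    exact ⟨rfl, rfl⟩
  · rintro ⟨h1, h2⟩
    refine (WithLp.linearEquiv 2 ℂ (H × K)).injective (Prod.ext ?_ ?_)
    · exact h1
    · exact h2

/-- The representation theorem for closed non-negative forms: the compression to `H` of the
projection onto the graph of `j` is the inverse of `1 + T`. -/
lemma exists_isInverseAddOne [CompleteSpace H] [CompleteSpace K] {D : Submodule ℂ H}
    {j : D →ₗ[ℂ] K} {q : D →ₗ⋆[ℂ] D →ₗ[ℂ] ℂ} (hq : ∀ u v, q u v = inner ℂ (j u) (j v))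
    (hD : Dense (D : Set H)) (hcl : IsClosed (hilbertGraph D j : Set (WithLp 2 (H × K)))) :
    ∃ R : H →L[ℂ] H, R.IsPositive ∧ IsInverseAddOne (formOperator D q) R ∧
      ∀ f, ∃ u : D, R f = u ∧ ∀ v : D,
        inner ℂ (j v) (j u) + inner ℂ (v : H) (u : H) = inner ℂ (v : H) f := by
  set W := hilbertGraph D j with hW
  have : CompleteSpace W := hcl.completeSpace_coe
  set π : WithLp 2 (H × K) →L[ℂ] H := WithLp.fstL 2 ℂ H K
  set R : H →L[ℂ] H := π ∘L W.starProjection ∘L π.adjoint with hR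
  have hspec : ∀ f, ∃ u : D, R f = u ∧ ∀ v : D,
      inner ℂ (j v) (j u) + inner ℂ (v : H) (u : H) = inner ℂ (v : H) f := by
    intro f
    obtain ⟨u, hu1, hu2⟩ := mem_hilbertGraph.1
      (Submodule.starProjection_apply_mem W (π.adjoint f))
    refine ⟨u, hu1.symm, fun v => ?_⟩
    set x : WithLp 2 (H × K) := WithLp.toLp 2 ((v : H), j v)
    have hx : x ∈ W := mem_hilbertGraph.2 ⟨v, rfl, rfl⟩
    have h1 : inner ℂ x (W.starProjection (π.adjoint f)) = inner ℂ (v : H) f := by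
      rw [← Submodule.inner_starProjection_left_eq_right, Submodule.starProjection_eq_self_iff.2 hx,
        ContinuousLinearMap.adjoint_inner_right]
      rfl
    rw [← h1, hu1, hu2, add_comm]
    rfl
  refine ⟨R, ?_, ?_, hspec⟩
  · exact (ContinuousLinearMap.IsPositive.of_isStarProjection
      isStarProjection_starProjection).conj_adjoint π
  · intro u f
    rw [formOperator_graph D q hD]
    obtain ⟨w, hw1, hw2⟩ := hspec (f + u)
    constructor
    · rintro ⟨hu, h⟩
      have h1 : ∀ v : D, inner ℂ (j v) (j (w - ⟨u, hu⟩)) + inner ℂ (v : H) ((w : H) - u) = 0 := by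
        intro v
        have h2 := h v
        have h3 := hw2 v
        rw [hq] at h2
        simp only at h2
        rw [inner_add_right, ← h2] at h3
        rw [map_sub, inner_sub_right, inner_sub_right]
        linear_combination h3
      have h2 := congrArg Complex.re (h1 (w - ⟨u, hu⟩))
      have h3 : 0 ≤ Complex.re (inner ℂ (j (w - ⟨u, hu⟩)) (j (w - ⟨u, hu⟩))) :=
        inner_self_nonneg (𝕜 := ℂ)
      have h4 : Complex.re (inner ℂ ((w : H) - u) ((w : H) - u)) = ‖(w : H) - u‖ ^ 2 :=
        inner_self_eq_norm_sq (𝕜 := ℂ) _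
      rw [Complex.add_re, show (((w - ⟨u, hu⟩ : D)) : H) = (w : H) - u from rfl, h4,
        Complex.zero_re] at h2
      have h5 : ‖(w : H) - u‖ ^ 2 = 0 := le_antisymm (by linarith) (sq_nonneg _)
      rw [hw1]
      exact sub_eq_zero.1 (norm_eq_zero.1 (pow_eq_zero_iff two_ne_zero |>.1 h5))
    · intro h
      have hwu : (w : H) = u := by rw [← hw1, h]
      refine ⟨hwu ▸ w.2, fun v => ?_⟩
      have h2 : (⟨u, hwu ▸ w.2⟩ : D) = w := Subtype.ext hwu.symm
      have h3 := hw2 v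
      rw [hwu, inner_add_right] at h3
      simp only at h2 ⊢
      rw [hq, h2]
      linear_combination h3

/-- A closed non-negative form that is at least `Λ` on a hyperplane and drops below `Λ` somewhere
gives a self-adjoint operator with a discrete eigenvalue below `Λ`. -/
lemma isSelfAdjoint_and_exists_mem_discreteSpectrum [CompleteSpace H] [CompleteSpace K]
    {D : Submodule ℂ H} {j : D →ₗ[ℂ] K} {q : D →ₗ⋆[ℂ] D →ₗ[ℂ] ℂ}
    (hq : ∀ u v, q u v = inner ℂ (j u) (j v)) (hD : Dense (D : Set H))
    (hcl : IsClosed (hilbertGraph D j : Set (WithLp 2 (H × K)))) {Λ : ℝ} (hΛ : 0 < 1 + Λ) {e : H}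
    (hgap : ∀ u : D, inner ℂ e (u : H) = 0 → Λ * ‖(u : H)‖ ^ 2 ≤ ‖j u‖ ^ 2)
    {u₀ : D} (hu₀ : ‖j u₀‖ ^ 2 < Λ * ‖(u₀ : H)‖ ^ 2) :
    IsSelfAdjoint (formOperator D q) ∧
      ∃ E : ℝ, (E : ℂ) ∈ discreteSpectrum (formOperator D q) ∧ E < Λ := by
  obtain ⟨R, hpos, hinv, hspec⟩ := exists_isInverseAddOne hq hD hcl
  have hc : 0 < (1 + Λ)⁻¹ := inv_pos.2 hΛ
  -- testing the equation for `u = R f` with `u` itself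
  have henergy : ∀ (f : H) (u : D), (∀ v : D,
      inner ℂ (j v) (j u) + inner ℂ (v : H) (u : H) = inner ℂ (v : H) f) →
      ‖j u‖ ^ 2 + ‖(u : H)‖ ^ 2 ≤ ‖(u : H)‖ * ‖f‖ := by
    intro f u h
    have h1 := congrArg Complex.re (h u)
    have h2 : Complex.re (inner ℂ (u : H) (u : H)) = ‖(u : H)‖ ^ 2 :=
      inner_self_eq_norm_sq (𝕜 := ℂ) _
    have h3 : Complex.re (inner ℂ (j u) (j u)) = ‖j u‖ ^ 2 :=
      inner_self_eq_norm_sq (𝕜 := ℂ) _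
    have h4 : Complex.re (inner ℂ (u : H) f) ≤ ‖(u : H)‖ * ‖f‖ := re_inner_le_norm (𝕜 := ℂ) _ _
    rw [Complex.add_re, h2, h3] at h1
    linarith
  refine ⟨hinv.isSelfAdjoint hpos.isSelfAdjoint, ?_⟩
  refine hinv.exists_mem_discreteSpectrum hpos (e := R e) hΛ (fun f hf => ?_) ?_
  · obtain ⟨u, hu, h⟩ := hspec f
    have h1 : inner ℂ e (u : H) = 0 := by
      rw [← hu, ← hf]
      exact (hpos.isSelfAdjoint.isSymmetric e f).symm
    have h2 := hgap u h1
    have h3 := henergy f u h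
    rw [hu, inv_mul_eq_div, le_div_iff₀ hΛ]
    by_cases h0 : ‖(u : H)‖ = 0
    · rw [h0, zero_mul]; exact norm_nonneg _
    · have h4 : 0 < ‖(u : H)‖ := lt_of_le_of_ne (norm_nonneg _) (Ne.symm h0)
      refine le_of_mul_le_mul_left ?_ h4
      nlinarith
  · by_contra! hle
    obtain ⟨u, hu, h⟩ := hspec (u₀ : H)
    have h1 := henergy _ u h
    have h2 : ‖(u : H)‖ ≤ (1 + Λ)⁻¹ * ‖(u₀ : H)‖ := by
      rw [← hu]
      exact R.le_of_opNorm_le hle _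
    have h3 : ‖(u₀ : H)‖ ^ 2 ≤ ‖j u₀‖ * ‖j u‖ + ‖(u₀ : H)‖ * ‖(u : H)‖ := by
      have h4 : ((‖(u₀ : H)‖ ^ 2 : ℝ) : ℂ) = inner ℂ (u₀ : H) (u₀ : H) := by
        rw [inner_self_eq_norm_sq_to_K]; push_cast; rfl
      have h5 : ‖(u₀ : H)‖ ^ 2 = ‖inner ℂ (u₀ : H) (u₀ : H)‖ := by
        rw [← h4, Complex.norm_real, Real.norm_of_nonneg (sq_nonneg _)]
      rw [h5, ← h u₀]
      exact (norm_add_le _ _).trans (add_le_add (norm_inner_le_norm _ _) (norm_inner_le_norm _ _))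
    have h0 : 0 < ‖(u₀ : H)‖ := by
      refine norm_pos_iff.2 fun h0 => ?_
      rw [h0, norm_zero] at hu₀
      have := sq_nonneg ‖j u₀‖
      simp at hu₀
      linarith
    have hcs : (‖j u₀‖ * ‖j u‖ + ‖(u₀ : H)‖ * ‖(u : H)‖) ^ 2 ≤
        (‖j u₀‖ ^ 2 + ‖(u₀ : H)‖ ^ 2) * (‖j u‖ ^ 2 + ‖(u : H)‖ ^ 2) := by
      nlinarith [sq_nonneg (‖j u₀‖ * ‖(u : H)‖ - ‖(u₀ : H)‖ * ‖j u‖)]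
    have h6 : ‖j u‖ ^ 2 + ‖(u : H)‖ ^ 2 ≤ (1 + Λ)⁻¹ * ‖(u₀ : H)‖ ^ 2 := by nlinarith
    have h7 : ‖j u₀‖ ^ 2 + ‖(u₀ : H)‖ ^ 2 < (1 + Λ) * ‖(u₀ : H)‖ ^ 2 := by linarith
    have h8 : 0 < (1 + Λ)⁻¹ * ‖(u₀ : H)‖ ^ 2 := by positivity
    have h9 : (‖(u₀ : H)‖ ^ 2) ^ 2 < (‖(u₀ : H)‖ ^ 2) ^ 2 := by
      calc (‖(u₀ : H)‖ ^ 2) ^ 2 ≤ (‖j u₀‖ * ‖j u‖ + ‖(u₀ : H)‖ * ‖(u : H)‖) ^ 2 := by gcongr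
        _ ≤ _ := hcs
        _ ≤ (‖j u₀‖ ^ 2 + ‖(u₀ : H)‖ ^ 2) * ((1 + Λ)⁻¹ * ‖(u₀ : H)‖ ^ 2) := by gcongr
        _ < ((1 + Λ) * ‖(u₀ : H)‖ ^ 2) * ((1 + Λ)⁻¹ * ‖(u₀ : H)‖ ^ 2) := by gcongr
        _ = (‖(u₀ : H)‖ ^ 2) ^ 2 := by field_simp
    exact lt_irrefl _ h9

end Form

/-! ### Smooth approximation and closedness of the form -/

/-- Smooth compactly supported functions on the plane, without any condition at `∂Ω`. -/
def IsSmoothCompact (φ : ℝ × ℝ → ℂ) : Prop := ContDiff ℝ ∞ φ ∧ HasCompactSupport φ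

lemma IsSmoothCompact.memLp {φ : ℝ × ℝ → ℂ} (h : IsSmoothCompact φ) (Ω : Set (ℝ × ℝ)) :
    MemLp φ 2 ((volume : Measure (ℝ × ℝ)).restrict Ω) :=
  h.1.continuous.memLp_of_hasCompactSupport h.2

lemma IsSmoothCompact.memLp_partial {φ : ℝ × ℝ → ℂ} (h : IsSmoothCompact φ) (Ω : Set (ℝ × ℝ))
    (e : ℝ × ℝ) :
    MemLp (fun p => fderiv ℝ φ p e) 2 ((volume : Measure (ℝ × ℝ)).restrict Ω) :=
  (continuous_partial h.1 e).memLp_of_hasCompactSupport (hasCompactSupport_partial h.2 e)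

/-- The restriction of a smooth function is weakly differentiable, by integration by parts on the
whole plane against test functions supported inside `Ω`. -/
lemma IsSmoothCompact.mem_weakPartialGraph {ψ : ℝ × ℝ → ℂ} (hψ : IsSmoothCompact ψ)
    (Ω : Set (ℝ × ℝ)) (e : ℝ × ℝ) :
    ((hψ.memLp Ω).toLp, (hψ.memLp_partial Ω e).toLp) ∈ weakPartialGraph Ω e := by
  intro φ hφ
  have aux : ∀ f g : ℝ × ℝ → ℂ, tsupport g ⊆ interior Ω →
      ∫ p in Ω, f p * g p = ∫ p, f p * g p := by
    intro f g hf
    refine setIntegral_eq_integral_of_forall_compl_eq_zero fun p hp => ?_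
    rw [image_eq_zero_of_notMem_tsupport fun h => hp (interior_subset (hf h)), mul_zero]
  have i1 : ∫ p in Ω, ((hψ.memLp Ω).toLp : L2 Ω) p * fderiv ℝ φ p e
      = ∫ p in Ω, ψ p * fderiv ℝ φ p e :=
    integral_congr_ae ((hψ.memLp Ω).coeFn_toLp.mono fun p hp => by simp only [hp])
  have i2 : ∫ p in Ω, ((hψ.memLp_partial Ω e).toLp : L2 Ω) p * φ p
      = ∫ p in Ω, fderiv ℝ ψ p e * φ p :=
    integral_congr_ae ((hψ.memLp_partial Ω e).coeFn_toLp.mono fun p hp => by simp only [hp])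
  rw [i1, i2, aux _ _ hφ.2.2, aux _ _ ((tsupport_fderiv_apply_subset ℝ e).trans hφ.2.2)]
  have c1 := hψ.1.continuous
  have c2 := hφ.1.continuous
  have c3 := continuous_partial hψ.1 e
  have c4 := continuous_partial hφ.1 e
  exact integral_mul_fderiv_eq_neg_fderiv_mul_of_integrable
    ((c3.mul c2).integrable_of_hasCompactSupport hφ.2.1.mul_left)
    ((c1.mul c4).integrable_of_hasCompactSupport hψ.2.mul_right)
    ((c1.mul c2).integrable_of_hasCompactSupport hψ.2.mul_right)
    (fun p _ => hψ.1.differentiable (by simp) p) (fun p _ => hφ.1.differentiable (by simp) p)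

/-- The gradient as a map from the form domain to `L² ⊕ L²`. -/
def gradient (d : ℝ) : formDomain d →ₗ[ℂ] WithLp 2 (L2 (pencil d) × L2 (pencil d)) :=
  (WithLp.linearEquiv 2 ℂ (L2 (pencil d) × L2 (pencil d))).symm.toLinearMap ∘ₗ
    (dx.prod dy) ∘ₗ Submodule.inclusion (formDomain_le d)

lemma form_eq_inner_gradient {d : ℝ} (u v : formDomain d) :
    form d u v = inner ℂ (gradient d u) (gradient d v) := rfl

lemma dx_mem_weakPartialGraph {d : ℝ} (u : H1 (pencil d)) :
    ((u : L2 (pencil d)), dx u) ∈ weakPartialGraph (pencil d) (1, 0) := by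
  rw [← weakPartial_graph (volume_frontier_pencil d)]
  exact LinearPMap.mem_graph (weakPartial (pencil d) (1, 0)) ⟨u, u.2.1⟩

lemma dy_mem_weakPartialGraph {d : ℝ} (u : H1 (pencil d)) :
    ((u : L2 (pencil d)), dy u) ∈ weakPartialGraph (pencil d) (0, 1) := by
  rw [← weakPartial_graph (volume_frontier_pencil d)]
  exact LinearPMap.mem_graph (weakPartial (pencil d) (0, 1)) ⟨u, u.2.2⟩

/-- Membership in the form domain, with prescribed weak derivatives. -/
lemma exists_formDomain {d : ℝ} {u a b : L2 (pencil d)}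
    (ha : (u, a) ∈ weakPartialGraph (pencil d) (1, 0))
    (hb : (u, b) ∈ weakPartialGraph (pencil d) (0, 1))
    (h : ∃ φ : ℕ → ℝ × ℝ → ℂ, (∀ n, IsSmoothCompact (φ n)) ∧
      Tendsto (fun n => eLpNorm (fun p => φ n p - u p) 2 (volume.restrict (pencil d)))
        atTop (𝓝 0) ∧
      Tendsto (fun n => eLpNorm (fun p => fderiv ℝ (φ n) p (1, 0) - a p) 2
        (volume.restrict (pencil d))) atTop (𝓝 0) ∧
      Tendsto (fun n => eLpNorm (fun p => fderiv ℝ (φ n) p (0, 1) - b p) 2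
        (volume.restrict (pencil d))) atTop (𝓝 0) ∧
      Tendsto (fun n => eLpNorm (φ n) 2 (wallMeasure d)) atTop (𝓝 0)) :
    ∃ v : formDomain d, (v : L2 (pencil d)) = u ∧ (gradient d v).fst = a ∧
      (gradient d v).snd = b := by
  rw [← weakPartial_graph (volume_frontier_pencil d)] at ha hb
  have m : u ∈ H1 (pencil d) := Submodule.mem_inf.2 ⟨LinearPMap.mem_domain_iff.2 ⟨_, ha⟩,
    LinearPMap.mem_domain_iff.2 ⟨_, hb⟩⟩
  have e1 : dx (⟨u, m⟩ : H1 (pencil d)) = a := dx_eq ha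
  have e2 : dy (⟨u, m⟩ : H1 (pencil d)) = b := dy_eq hb
  obtain ⟨φ, h0, h1, h2, h3, h4⟩ := h
  have ht : HasTrace (wallMeasure d) (⟨u, m⟩ : H1 (pencil d)) 0 :=
    ⟨φ, h0, h1, by rw [e1]; exact h2, by rw [e2]; exact h3, by simpa using h4⟩
  exact ⟨⟨u, Submodule.mem_map.2 ⟨⟨u, m⟩, ht, rfl⟩⟩, rfl, e1, e2⟩

/-- Approximation of elements of the form domain by smooth functions. -/
lemma exists_approx {d : ℝ} (u : formDomain d) :
    ∃ φ : ℕ → ℝ × ℝ → ℂ, (∀ n, IsSmoothCompact (φ n)) ∧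
      Tendsto (fun n => eLpNorm (fun p => φ n p - (u : L2 (pencil d)) p) 2
        (volume.restrict (pencil d))) atTop (𝓝 0) ∧
      Tendsto (fun n => eLpNorm (fun p => fderiv ℝ (φ n) p (1, 0) - (gradient d u).fst p) 2
        (volume.restrict (pencil d))) atTop (𝓝 0) ∧
      Tendsto (fun n => eLpNorm (fun p => fderiv ℝ (φ n) p (0, 1) - (gradient d u).snd p) 2
        (volume.restrict (pencil d))) atTop (𝓝 0) ∧
      Tendsto (fun n => eLpNorm (φ n) 2 (wallMeasure d)) atTop (𝓝 0) := by
  obtain ⟨u, hu⟩ := u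
  obtain ⟨v, ⟨φ, h0, h1, h2, h3, h4⟩, rfl⟩ := Submodule.mem_map.1 hu
  exact ⟨φ, h0, h1, h2, h3, by simpa using h4⟩

lemma continuous_integral_mul {Ω : Set (ℝ × ℝ)} {φ : ℝ × ℝ → ℂ}
    (hφ : MemLp φ 2 ((volume : Measure (ℝ × ℝ)).restrict Ω)) :
    Continuous (fun w : L2 Ω => ∫ p in Ω, w p * φ p) := by
  have h : (fun w : L2 Ω => ∫ p in Ω, w p * φ p) = fun w => inner ℂ (hφ.star.toLp) w := by
    ext w
    rw [L2.inner_def]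
    refine integral_congr_ae (hφ.star.coeFn_toLp.mono fun p hp => ?_)
    simp only [hp, RCLike.inner_apply]
    simp
  rw [h]
  fun_prop

lemma isClosed_weakPartialGraph (Ω : Set (ℝ × ℝ)) (e : ℝ × ℝ) :
    IsClosed (weakPartialGraph Ω e : Set (L2 Ω × L2 Ω)) := by
  have h : (weakPartialGraph Ω e : Set (L2 Ω × L2 Ω)) =
      ⋂ (φ : ℝ × ℝ → ℂ) (_ : IsTestFunction Ω φ),
        {q | ∫ p in Ω, q.1 p * fderiv ℝ φ p e = - ∫ p in Ω, q.2 p * φ p} := by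
    ext q
    simp only [Set.mem_iInter]
    rfl
  rw [h]
  refine isClosed_iInter fun φ => isClosed_iInter fun hφ => isClosed_eq ?_ ?_
  · exact (continuous_integral_mul (hφ.memLp_partial e)).comp continuous_fst
  · exact ((continuous_integral_mul hφ.memLp).comp continuous_snd).neg

lemma tendsto_eLpNorm_sub_of_tendsto {Ω : Set (ℝ × ℝ)} {f : ℕ → ℝ × ℝ → ℂ}
    (hf : ∀ n, Continuous (f n)) {w : ℕ → L2 Ω} {w' : L2 Ω} (hw : Tendsto w atTop (𝓝 w'))
    {ε : ℕ → ENNReal} (hε : Tendsto ε atTop (𝓝 0))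
    (h : ∀ n, eLpNorm (fun p => f n p - w n p) 2 (volume.restrict Ω) ≤ ε n) :
    Tendsto (fun n => eLpNorm (fun p => f n p - w' p) 2 (volume.restrict Ω)) atTop (𝓝 0) := by
  have h1 : Tendsto (fun n => ε n + edist (w n) w') atTop (𝓝 0) := by
    simpa using hε.add (tendsto_iff_edist_tendsto_0.1 hw)
  refine tendsto_of_tendsto_of_tendsto_of_le_of_le tendsto_const_nhds h1 (fun _ => zero_le)
    fun n => ?_
  have h2 : (fun p => f n p - w' p) = (fun p => f n p - w n p) + fun p => w n p - w' p := by
    ext p; simp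
  rw [h2, Lp.edist_def]
  exact (eLpNorm_add_le ((hf n).aestronglyMeasurable.sub (Lp.aestronglyMeasurable _))
    ((Lp.aestronglyMeasurable _).sub (Lp.aestronglyMeasurable _)) (by norm_num)).trans
    (add_le_add (h n) le_rfl)

/-- The form is closed: a diagonal sequence of smooth approximations shows that a limit in the
`H¹` norm of functions with zero trace has zero trace. -/
lemma isClosed_hilbertGraph_gradient (d : ℝ) :
    IsClosed (hilbertGraph (formDomain d) (gradient d) :
      Set (WithLp 2 (L2 (pencil d) × WithLp 2 (L2 (pencil d) × L2 (pencil d))))) := by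
  refine IsSeqClosed.isClosed fun x y hx hxy => ?_
  have hx' : ∀ n, ∃ u : formDomain d, (u : L2 (pencil d)) = (x n).fst ∧
      gradient d u = (x n).snd := fun n => mem_hilbertGraph.1 (hx n)
  choose u hu1 hu2 using hx'
  have t1 : Tendsto (fun n => (u n : L2 (pencil d))) atTop (𝓝 y.fst) := by
    simp only [hu1]
    exact ((WithLp.fstL 2 ℂ _ _).continuous.tendsto y).comp hxy
  have t2 : Tendsto (fun n => gradient d (u n)) atTop (𝓝 y.snd) := by
    simp only [hu2]
    exact ((WithLp.sndL 2 ℂ _ _).continuous.tendsto y).comp hxy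
  have t3 : Tendsto (fun n => (gradient d (u n)).fst) atTop (𝓝 y.snd.fst) :=
    ((WithLp.fstL 2 ℂ _ _).continuous.tendsto _).comp t2
  have t4 : Tendsto (fun n => (gradient d (u n)).snd) atTop (𝓝 y.snd.snd) :=
    ((WithLp.sndL 2 ℂ _ _).continuous.tendsto _).comp t2
  have hε : ∀ n : ℕ, (0 : ENNReal) < (n : ENNReal)⁻¹ := fun n => by simp
  have hφ : ∀ n : ℕ, ∃ φ : ℝ × ℝ → ℂ, IsSmoothCompact φ ∧
      eLpNorm (fun p => φ p - (u n : L2 (pencil d)) p) 2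
        (volume.restrict (pencil d)) ≤ (n : ENNReal)⁻¹ ∧
      eLpNorm (fun p => fderiv ℝ φ p (1, 0) - (gradient d (u n)).fst p) 2
        (volume.restrict (pencil d)) ≤ (n : ENNReal)⁻¹ ∧
      eLpNorm (fun p => fderiv ℝ φ p (0, 1) - (gradient d (u n)).snd p) 2
        (volume.restrict (pencil d)) ≤ (n : ENNReal)⁻¹ ∧
      eLpNorm φ 2 (wallMeasure d) ≤ (n : ENNReal)⁻¹ := by
    intro n
    obtain ⟨φ, h0, h1, h2, h3, h4⟩ := exists_approx (u n)
    obtain ⟨m, m1, m2, m3, m4⟩ := ((h1.eventually_le_const (hε n)).and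
      ((h2.eventually_le_const (hε n)).and ((h3.eventually_le_const (hε n)).and
        (h4.eventually_le_const (hε n))))).exists
    exact ⟨φ m, h0 m, m1, m2, m3, m4⟩
  choose φ h0 h1 h2 h3 h4 using hφ
  have hlim : Tendsto (fun n : ℕ => (n : ENNReal)⁻¹) atTop (𝓝 0) :=
    ENNReal.tendsto_inv_nat_nhds_zero
  obtain ⟨v, hv1, hv2, hv3⟩ := exists_formDomain (u := y.fst) (a := y.snd.fst) (b := y.snd.snd)
    ((isClosed_weakPartialGraph _ _).mem_of_tendsto (t1.prodMk_nhds t3)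
      (Eventually.of_forall fun n => dx_mem_weakPartialGraph
        (Submodule.inclusion (formDomain_le d) (u n))))
    ((isClosed_weakPartialGraph _ _).mem_of_tendsto (t1.prodMk_nhds t4)
      (Eventually.of_forall fun n => dy_mem_weakPartialGraph
        (Submodule.inclusion (formDomain_le d) (u n))))
    ⟨φ, h0, tendsto_eLpNorm_sub_of_tendsto (fun n => (h0 n).1.continuous) t1 hlim h1,
      tendsto_eLpNorm_sub_of_tendsto (fun n => continuous_partial (h0 n).1 _) t3 hlim h2,
      tendsto_eLpNorm_sub_of_tendsto (fun n => continuous_partial (h0 n).1 _) t4 hlim h3,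
      tendsto_of_tendsto_of_tendsto_of_le_of_le tendsto_const_nhds hlim (fun _ => zero_le) h4⟩
  refine mem_hilbertGraph.2 ⟨v, hv1, ?_⟩
  refine (WithLp.linearEquiv 2 ℂ (L2 (pencil d) × L2 (pencil d))).injective (Prod.ext hv2 hv3)

lemma eLpNorm_wallMeasure_eq_zero {d : ℝ} {ψ : ℝ × ℝ → ℂ} (hψ : Measurable ψ)
    (h : ∀ p : ℝ × ℝ, |p.1 - p.2| = |d| → ψ p = 0) : eLpNorm ψ 2 (wallMeasure d) = 0 := by
  rw [eLpNorm_congr_ae (g := fun _ => (0 : ℂ))]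
  · simp
  have hS : MeasurableSet {p : ℝ × ℝ | ψ p = 0} := measurableSet_eq_fun hψ measurable_const
  refine ae_add_measure_iff.2 ⟨?_, ?_⟩
  · refine (ae_map_iff (by fun_prop) hS).2 (ae_of_all _ fun t => ?_)
    simp [h]
  · refine (ae_map_iff (by fun_prop) hS).2 (ae_of_all _ fun t => ?_)
    simp [h]

/-- A smooth function that vanishes on the two walls belongs to the form domain. -/
lemma IsSmoothCompact.exists_formDomain {d : ℝ} {ψ : ℝ × ℝ → ℂ} (hψ : IsSmoothCompact ψ)
    (h : ∀ p : ℝ × ℝ, |p.1 - p.2| = |d| → ψ p = 0) :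
    ∃ u : formDomain d, (u : L2 (pencil d)) = (hψ.memLp (pencil d)).toLp ∧
      (gradient d u).fst = (hψ.memLp_partial (pencil d) (1, 0)).toLp ∧
      (gradient d u).snd = (hψ.memLp_partial (pencil d) (0, 1)).toLp := by
  have key : ∀ (f : ℝ × ℝ → ℂ) (hf : MemLp f 2 (volume.restrict (pencil d))),
      Tendsto (fun _ : ℕ => eLpNorm (fun p => f p - (hf.toLp : L2 (pencil d)) p) 2
        (volume.restrict (pencil d))) atTop (𝓝 0) := by
    intro f hf
    have : eLpNorm (fun p => f p - (hf.toLp : L2 (pencil d)) p) 2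
        (volume.restrict (pencil d)) = 0 := by
      rw [eLpNorm_congr_ae (g := fun _ => (0 : ℂ))
        (hf.coeFn_toLp.mono fun p hp => by simp only [hp, sub_self])]
      simp
    rw [this]
    exact tendsto_const_nhds
  refine PencilSpectrum.exists_formDomain (hψ.mem_weakPartialGraph _ _)
    (hψ.mem_weakPartialGraph _ _) ⟨fun _ => ψ, fun _ => hψ, key _ _, key _ _, key _ _, ?_⟩
  simp only [eLpNorm_wallMeasure_eq_zero hψ.1.continuous.measurable h]
  exact tendsto_const_nhds

/-! ### Friedrichs and Wirtinger inequalities on an interval -/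

section OneDimensional

/-- Friedrichs' inequality on an interval, Dirichlet at `a` and Neumann at `b`, with a boundary term
instead of the condition `f a = 0`. -/
lemma friedrichs_left {f f' : ℝ → ℂ} (hf : ∀ t, HasDerivAt f (f' t) t) (hf' : Continuous f')
    {a b k l : ℝ} (hab : a ≤ b) (hk : 0 < k) (hl : b - a ≤ l) (hkl : k * l < Real.pi / 2) :
    k ^ 2 * ∫ t in a..b, ‖f t‖ ^ 2 ≤
      (∫ t in a..b, ‖f' t‖ ^ 2) + k * Real.tan (k * l) * ‖f a‖ ^ 2 := by
  have hfc : Continuous f := continuous_iff_continuousAt.2 fun t => (hf t).continuousAt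
  -- `G` is the logarithmic derivative of the ground state `cos (k (b - t))`
  set G : ℝ → ℝ := fun t => k * Real.tan (k * (b - t)) with hG
  have hangle : ∀ t ∈ Set.Icc a b, 0 ≤ k * (b - t) ∧ k * (b - t) < Real.pi / 2 := by
    intro t ht
    refine ⟨mul_nonneg hk.le (by linarith [ht.2]), lt_of_le_of_lt ?_ hkl⟩
    gcongr
    linarith [ht.1]
  have hcos : ∀ t ∈ Set.Icc a b, Real.cos (k * (b - t)) ≠ 0 := fun t ht =>
    (Real.cos_pos_of_mem_Ioo ⟨by linarith [(hangle t ht).1, Real.pi_pos], (hangle t ht).2⟩).ne'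
  have hGd : ∀ t ∈ Set.Icc a b, HasDerivAt G (-(k ^ 2 + G t ^ 2)) t := by
    intro t ht
    have h1 : HasDerivAt (fun t => k * (b - t)) (k * (-1)) t :=
      ((hasDerivAt_id t).const_sub b).const_mul k
    have h2 := ((Real.hasDerivAt_tan (hcos t ht)).comp t h1).const_mul k
    refine h2.congr_deriv ?_
    have h3 := hcos t ht
    simp only [hG, Real.tan_eq_sin_div_cos]
    field_simp
    linear_combination Real.sin_sq_add_cos_sq (k * (b - t))
  have hFd : ∀ t ∈ Set.Icc a b, HasDerivAt (fun t => G t * ‖f t‖ ^ 2)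
      (-(k ^ 2 + G t ^ 2) * ‖f t‖ ^ 2 + G t * (2 * inner ℝ (f t) (f' t))) t := fun t ht =>
    (hGd t ht).mul (hf t).norm_sq
  have hGc : ContinuousOn G (Set.Icc a b) := fun t ht => (hGd t ht).continuousAt.continuousWithinAt
  have hint : IntervalIntegrable
      (fun t => -(k ^ 2 + G t ^ 2) * ‖f t‖ ^ 2 + G t * (2 * inner ℝ (f t) (f' t))) volume a b := by
    refine ContinuousOn.intervalIntegrable ?_
    rw [Set.uIcc_of_le hab]
    have h1 : ContinuousOn (fun t => inner ℝ (f t) (f' t)) (Set.Icc a b) :=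
      (hfc.inner hf').continuousOn
    have h2 : ContinuousOn (fun t => ‖f t‖ ^ 2) (Set.Icc a b) := (hfc.norm.pow 2).continuousOn
    fun_prop
  have hftc := intervalIntegral.integral_eq_sub_of_hasDerivAt
    (fun t ht => hFd t (by rwa [Set.uIcc_of_le hab] at ht)) hint
  have hi1 : IntervalIntegrable (fun t => ‖f' t‖ ^ 2) volume a b :=
    (hf'.norm.pow 2).intervalIntegrable _ _
  have hi2 : IntervalIntegrable (fun t => k ^ 2 * ‖f t‖ ^ 2) volume a b :=
    ((hfc.norm.pow 2).const_mul _).intervalIntegrable _ _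
  -- `(G ‖f‖²)' ≤ ‖f'‖² - k² ‖f‖²` because the difference is `‖f' - G f‖²`
  have hmono := intervalIntegral.integral_mono_on hab hint (hi1.sub hi2) (fun t ht => by
    have h1 : 0 ≤ ‖f' t - G t • f t‖ ^ 2 := sq_nonneg _
    rw [norm_sub_sq_real, norm_smul, inner_smul_right, real_inner_comm, mul_pow,
      Real.norm_eq_abs, sq_abs] at h1
    linarith)
  rw [hftc, intervalIntegral.integral_sub hi1 hi2, intervalIntegral.integral_const_mul] at hmono
  have hGb : G b = 0 := by simp [hG]
  have hGa : G a ≤ k * Real.tan (k * l) := by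
    have h1 := hangle a ⟨le_rfl, hab⟩
    have h2 : k * (b - a) ≤ k * l := by gcongr
    refine mul_le_mul_of_nonneg_left ?_ hk.le
    exact Real.strictMonoOn_tan.monotoneOn ⟨by linarith [Real.pi_pos], h1.2⟩
      ⟨by linarith [Real.pi_pos], hkl⟩ h2
  have h3 : G a * ‖f a‖ ^ 2 ≤ k * Real.tan (k * l) * ‖f a‖ ^ 2 := by gcongr
  rw [hGb] at hmono
  linarith

lemma friedrichs_right {f f' : ℝ → ℂ} (hf : ∀ t, HasDerivAt f (f' t) t) (hf' : Continuous f')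
    {a b k l : ℝ} (hab : a ≤ b) (hk : 0 < k) (hl : b - a ≤ l) (hkl : k * l < Real.pi / 2) :
    k ^ 2 * ∫ t in a..b, ‖f t‖ ^ 2 ≤
      (∫ t in a..b, ‖f' t‖ ^ 2) + k * Real.tan (k * l) * ‖f b‖ ^ 2 := by
  have h := friedrichs_left (f := fun t => f (-t)) (f' := fun t => -f' (-t))
    (fun t => by
      have h1 := (hf (-t)).scomp t (hasDerivAt_neg t)
      simpa [Function.comp_def] using h1)
    (by fun_prop) (neg_le_neg hab) hk (by linarith : -a - -b ≤ l) hkl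
  rw [intervalIntegral.integral_comp_neg (fun t => ‖f t‖ ^ 2)] at h
  simp only [norm_neg] at h
  rw [intervalIntegral.integral_comp_neg (fun t => ‖f' t‖ ^ 2)] at h
  simpa using h

lemma integral_norm_sub_sq {f : ℝ → ℂ} (hfc : Continuous f) (c : ℂ) (a b : ℝ) :
    ∫ t in a..b, ‖f t - c‖ ^ 2 =
      (∫ t in a..b, ‖f t‖ ^ 2) - 2 * inner ℝ c (∫ t in a..b, f t) + (b - a) * ‖c‖ ^ 2 := by
  have i3 : IntervalIntegrable (fun t => ‖f t‖ ^ 2) volume a b :=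
    (hfc.norm.pow 2).intervalIntegrable _ _
  have i4 : IntervalIntegrable (fun t => 2 * inner ℝ c (f t)) volume a b :=
    (continuous_const.mul (continuous_const.inner hfc)).intervalIntegrable _ _
  have e1 : ∀ t, ‖f t - c‖ ^ 2 = ‖f t‖ ^ 2 - 2 * inner ℝ c (f t) + ‖c‖ ^ 2 := fun t => by
    rw [norm_sub_sq_real, real_inner_comm]
  have e2 : ∫ t in a..b, inner ℝ c (f t) = inner ℝ c (∫ t in a..b, f t) :=
    (innerSL ℝ c).intervalIntegral_comp_comm (hfc.intervalIntegrable a b)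
  simp only [e1]
  rw [intervalIntegral.integral_add (i3.sub i4) (by simp), intervalIntegral.integral_sub i3 i4,
    intervalIntegral.integral_const_mul, e2, intervalIntegral.integral_const, smul_eq_mul]

lemma norm_integral_sq_le {f : ℝ → ℂ} (hfc : Continuous f) {a b : ℝ} (hab : a < b) :
    ‖∫ t in a..b, f t‖ ^ 2 ≤ (b - a) * ∫ t in a..b, ‖f t‖ ^ 2 := by
  have hba : 0 < b - a := sub_pos.2 hab
  set I := ∫ t in a..b, f t with hI
  have h1 := integral_norm_sub_sq hfc ((b - a)⁻¹ • I) a b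
  have h2 : 0 ≤ ∫ t in a..b, ‖f t - (b - a)⁻¹ • I‖ ^ 2 :=
    intervalIntegral.integral_nonneg hab.le fun t _ => sq_nonneg _
  rw [h1, ← hI, real_inner_smul_left, real_inner_self_eq_norm_sq, norm_smul, Real.norm_eq_abs,
    mul_pow, sq_abs] at h2
  have h3 : (b - a) * ((b - a)⁻¹ ^ 2 * ‖I‖ ^ 2) = (b - a)⁻¹ * ‖I‖ ^ 2 := by
    field_simp
  have h4 : (b - a)⁻¹ * ‖I‖ ^ 2 ≤ ∫ t in a..b, ‖f t‖ ^ 2 := by linarith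
  rwa [inv_mul_eq_div, div_le_iff₀' hba] at h4

/-- Wirtinger's inequality: subtracting the value at the midpoint reduces it to Friedrichs'
inequality on the two halves of the interval. -/
lemma wirtinger {f f' : ℝ → ℂ} (hf : ∀ t, HasDerivAt f (f' t) t) (hf' : Continuous f')
    {a b k : ℝ} (hab : a < b) (hk : 0 < k) (hkl : k * (b - a) < Real.pi) :
    k ^ 2 * ∫ t in a..b, ‖f t‖ ^ 2 ≤
      (∫ t in a..b, ‖f' t‖ ^ 2) + k ^ 2 / (b - a) * ‖∫ t in a..b, f t‖ ^ 2 := by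
  have hfc : Continuous f := continuous_iff_continuousAt.2 fun t => (hf t).continuousAt
  set m := (a + b) / 2 with hm
  set c := f m with hc
  have hg : ∀ t, HasDerivAt (fun t => f t - c) (f' t) t := fun t => (hf t).sub_const c
  have hl : k * ((b - a) / 2) < Real.pi / 2 := by linarith
  have h1 := friedrichs_left hg hf' (a := m) (b := b) (by linarith) hk
    (by linarith : b - m ≤ (b - a) / 2) hl
  have h2 := friedrichs_right hg hf' (a := a) (b := m) (by linarith) hk
    (by linarith : m - a ≤ (b - a) / 2) hl
  have e0 : ‖f m - c‖ ^ 2 = 0 := by simp [hc]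
  rw [e0] at h1 h2
  have i1 : ∀ x y, IntervalIntegrable (fun t => ‖f t - c‖ ^ 2) volume x y := fun x y =>
    ((hfc.sub continuous_const).norm.pow 2).intervalIntegrable _ _
  have i2 : ∀ x y, IntervalIntegrable (fun t => ‖f' t‖ ^ 2) volume x y := fun x y =>
    (hf'.norm.pow 2).intervalIntegrable _ _
  have a1 := intervalIntegral.integral_add_adjacent_intervals (i1 a m) (i1 m b)
  have a2 := intervalIntegral.integral_add_adjacent_intervals (i2 a m) (i2 m b)
  have h3 : k ^ 2 * ∫ t in a..b, ‖f t - c‖ ^ 2 ≤ ∫ t in a..b, ‖f' t‖ ^ 2 := by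
    rw [← a1, ← a2]; linarith
  have h4 := integral_norm_sub_sq hfc c a b
  set I := ∫ t in a..b, f t with hI
  have h5 : ‖I‖ ^ 2 / (b - a) - 2 * inner ℝ c I + (b - a) * ‖c‖ ^ 2 ≥ 0 := by
    have hba : 0 < b - a := sub_pos.2 hab
    have h6 : 2 * inner ℝ c I ≤ 2 * (‖c‖ * ‖I‖) := by
      gcongr
      exact real_inner_le_norm _ _
    have h7 : ‖I‖ ^ 2 / (b - a) - 2 * (‖c‖ * ‖I‖) + (b - a) * ‖c‖ ^ 2 =
        (‖I‖ - (b - a) * ‖c‖) ^ 2 / (b - a) := by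
      field_simp
      ring
    have h8 : 0 ≤ (‖I‖ - (b - a) * ‖c‖) ^ 2 / (b - a) := by positivity
    linarith
  have h9 : ∫ t in a..b, ‖f t‖ ^ 2 ≤ (∫ t in a..b, ‖f t - c‖ ^ 2) + ‖I‖ ^ 2 / (b - a) := by
    rw [h4]; linarith
  calc k ^ 2 * ∫ t in a..b, ‖f t‖ ^ 2
      ≤ k ^ 2 * ((∫ t in a..b, ‖f t - c‖ ^ 2) + ‖I‖ ^ 2 / (b - a)) := by gcongr
    _ = k ^ 2 * (∫ t in a..b, ‖f t - c‖ ^ 2) + k ^ 2 / (b - a) * ‖I‖ ^ 2 := by ring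
    _ ≤ _ := by linarith

end OneDimensional

/-! ### The corner square and the strips -/

section Regions

lemma enorm_sq_eq_ofReal (z : ℂ) : ‖z‖ₑ ^ 2 = ENNReal.ofReal (‖z‖ ^ 2) := by
  rw [ENNReal.ofReal_pow (norm_nonneg _), ofReal_norm]

lemma lintegral_enorm_sq {α : Type*} [MeasurableSpace α] {μ : Measure α} {g : α → ℂ}
    (h : Integrable (fun p => ‖g p‖ ^ 2) μ) :
    ∫⁻ p, ‖g p‖ₑ ^ 2 ∂μ = ENNReal.ofReal (∫ p, ‖g p‖ ^ 2 ∂μ) := by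
  rw [ofReal_integral_eq_lintegral_ofReal h (ae_of_all _ fun _ => sq_nonneg _)]
  simp only [enorm_sq_eq_ofReal]

lemma eLpNorm_two_sq {α : Type*} [MeasurableSpace α] (μ : Measure α) (g : α → ℂ) :
    eLpNorm g 2 μ ^ 2 = ∫⁻ p, ‖g p‖ₑ ^ 2 ∂μ := by
  have h := eLpNorm_nnreal_pow_eq_lintegral (f := g) (μ := μ) (p := 2) two_ne_zero
  simpa using h

lemma continuous_norm_sq {X : Type*} [TopologicalSpace X] {g : X → ℂ} (hg : Continuous g) :
    Continuous fun p => ‖g p‖ ^ 2 := hg.norm.pow 2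

/-- The square at the corner of the pencil. -/
def cornerSquare (d : ℝ) : Set (ℝ × ℝ) := Set.Icc 0 d ×ˢ Set.Icc 0 d

lemma isCompact_cornerSquare (d : ℝ) : IsCompact (cornerSquare d) :=
  isCompact_Icc.prod isCompact_Icc

lemma setIntegral_cornerSquare {E : Type*} [NormedAddCommGroup E] [NormedSpace ℝ E] {g : ℝ × ℝ → E}
    (hg : Continuous g) {d : ℝ} (hd : 0 ≤ d) :
    ∫ p in cornerSquare d, g p = ∫ x in 0..d, ∫ y in 0..d, g (x, y) := by
  rw [cornerSquare, Measure.volume_eq_prod, setIntegral_prod]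
  · simp only [integral_Icc_eq_integral_Ioc, intervalIntegral.integral_of_le hd]
  · rw [← Measure.volume_eq_prod]
    exact hg.continuousOn.integrableOn_compact (isCompact_cornerSquare d)

lemma hasDerivAt_slice {φ : ℝ × ℝ → ℂ} (h : IsSmoothCompact φ) {c : ℝ → ℝ × ℝ} {c' : ℝ × ℝ} {t : ℝ}
    (hc : HasDerivAt c c' t) : HasDerivAt (fun t => φ (c t)) (fderiv ℝ φ (c t) c') t :=
  ((h.1.differentiable (by simp) (c t)).hasFDerivAt).comp_hasDerivAt t hc

/-- Wirtinger's inequality on the corner square, first along vertical segments and then for the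
vertical averages. -/
lemma wirtinger_cornerSquare {φ : ℝ × ℝ → ℂ} (h : IsSmoothCompact φ) {d k : ℝ} (hd : 0 < d)
    (hk : 0 < k) (hkd : k * d < Real.pi) :
    k ^ 2 * ∫ p in cornerSquare d, ‖φ p‖ ^ 2 ≤
      (∫ p in cornerSquare d, ‖fderiv ℝ φ p (1, 0)‖ ^ 2) +
      (∫ p in cornerSquare d, ‖fderiv ℝ φ p (0, 1)‖ ^ 2) +
      k ^ 2 / d ^ 2 * ‖∫ p in cornerSquare d, φ p‖ ^ 2 := by
  have c0 : Continuous φ := h.1.continuous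
  have c1 : Continuous (fun p => fderiv ℝ φ p (1, 0)) := continuous_partial h.1 _
  have c2 : Continuous (fun p => fderiv ℝ φ p (0, 1)) := continuous_partial h.1 _
  have d1 : ∀ x y, HasDerivAt (fun x => φ (x, y)) (fderiv ℝ φ (x, y) (1, 0)) x := fun x y =>
    hasDerivAt_slice h ((hasDerivAt_id x).prodMk (hasDerivAt_const x y))
  have d2 : ∀ x y, HasDerivAt (fun y => φ (x, y)) (fderiv ℝ φ (x, y) (0, 1)) y := fun x y =>
    hasDerivAt_slice h ((hasDerivAt_const y x).prodMk (hasDerivAt_id y))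
  set M : ℝ → ℂ := fun x => ∫ y in 0..d, φ (x, y) with hM
  set M' : ℝ → ℂ := fun x => ∫ y in 0..d, fderiv ℝ φ (x, y) (1, 0) with hM'
  have hMd : ∀ x, HasDerivAt M (M' x) x := by
    intro x
    obtain ⟨C, hC⟩ := (hasCompactSupport_partial h.2 (1, 0)).exists_bound_of_continuous c1
    exact (intervalIntegral.hasDerivAt_integral_of_dominated_loc_of_deriv_le
      (F := fun x y => φ (x, y)) (bound := fun _ => C) univ_mem
      (Eventually.of_forall fun x =>
        (by fun_prop : Continuous fun y => φ (x, y)).aestronglyMeasurable)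
      ((by fun_prop : Continuous fun y => φ (x, y)).intervalIntegrable _ _)
      (c1.comp (by fun_prop : Continuous fun y => (x, y))).aestronglyMeasurable
      (ae_of_all _ fun y _ x _ => hC (x, y)) (by simp)
      (ae_of_all _ fun y _ x _ => d1 x y)).2
  have hM'c : Continuous M' :=
    intervalIntegral.continuous_parametric_intervalIntegral_of_continuous'
      (f := fun x y => fderiv ℝ φ (x, y) (1, 0)) c1 0 d
  have hMc : Continuous M := continuous_iff_continuousAt.2 fun x => (hMd x).continuousAt
  have cont : ∀ g : ℝ × ℝ → ℂ, Continuous g → Continuous fun x => ∫ y in 0..d, ‖g (x, y)‖ ^ 2 :=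
    fun g hg => intervalIntegral.continuous_parametric_intervalIntegral_of_continuous'
      (f := fun x y => ‖g (x, y)‖ ^ 2) (continuous_norm_sq hg) 0 d
  have w1 : ∀ x, k ^ 2 * ∫ y in 0..d, ‖φ (x, y)‖ ^ 2 ≤
      (∫ y in 0..d, ‖fderiv ℝ φ (x, y) (0, 1)‖ ^ 2) + k ^ 2 / d * ‖M x‖ ^ 2 := by
    intro x
    have := wirtinger (d2 x) (c2.comp (by fun_prop : Continuous fun y => (x, y))) hd hk
      (by rwa [sub_zero])
    simpa only [sub_zero] using this
  have w2 : k ^ 2 * ∫ x in 0..d, ‖M x‖ ^ 2 ≤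
      (∫ x in 0..d, ‖M' x‖ ^ 2) + k ^ 2 / d * ‖∫ x in 0..d, M x‖ ^ 2 := by
    have := wirtinger hMd hM'c hd hk (by rwa [sub_zero])
    simpa only [sub_zero] using this
  have w3 : ∫ x in 0..d, ‖M' x‖ ^ 2 ≤
      d * ∫ x in 0..d, ∫ y in 0..d, ‖fderiv ℝ φ (x, y) (1, 0)‖ ^ 2 := by
    rw [← intervalIntegral.integral_const_mul]
    refine intervalIntegral.integral_mono_on hd.le ((hM'c.norm.pow 2).intervalIntegrable _ _)
      (((cont _ c1).const_mul d).intervalIntegrable _ _) fun x _ => ?_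
    have := norm_integral_sq_le (f := fun y => fderiv ℝ φ (x, y) (1, 0))
      (c1.comp (by fun_prop : Continuous fun y => (x, y))) hd
    simpa only [sub_zero] using this
  have w4 : k ^ 2 * ∫ x in 0..d, ∫ y in 0..d, ‖φ (x, y)‖ ^ 2 ≤
      (∫ x in 0..d, ∫ y in 0..d, ‖fderiv ℝ φ (x, y) (0, 1)‖ ^ 2) +
        k ^ 2 / d * ∫ x in 0..d, ‖M x‖ ^ 2 := by
    have i1 := (cont _ c2).intervalIntegrable (μ := volume) 0 d
    have i2 := ((continuous_norm_sq hMc).const_mul (k ^ 2 / d)).intervalIntegrable (μ := volume) 0 d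
    rw [← intervalIntegral.integral_const_mul, ← intervalIntegral.integral_const_mul,
      ← intervalIntegral.integral_add i1 i2]
    exact intervalIntegral.integral_mono_on hd.le
      (((cont _ c0).const_mul _).intervalIntegrable _ _) (i1.add i2) fun x _ => w1 x
  rw [setIntegral_cornerSquare c0 hd.le, setIntegral_cornerSquare (continuous_norm_sq c0) hd.le,
    setIntegral_cornerSquare (continuous_norm_sq c1) hd.le,
    setIntegral_cornerSquare (continuous_norm_sq c2) hd.le]
  have w5 : k ^ 2 / d * ∫ x in 0..d, ‖M x‖ ^ 2 ≤
      (∫ x in 0..d, ∫ y in 0..d, ‖fderiv ℝ φ (x, y) (1, 0)‖ ^ 2) +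
        k ^ 2 / d ^ 2 * ‖∫ x in 0..d, M x‖ ^ 2 := by
    calc k ^ 2 / d * ∫ x in 0..d, ‖M x‖ ^ 2 = d⁻¹ * (k ^ 2 * ∫ x in 0..d, ‖M x‖ ^ 2) := by ring
      _ ≤ d⁻¹ * (d * (∫ x in 0..d, ∫ y in 0..d, ‖fderiv ℝ φ (x, y) (1, 0)‖ ^ 2) +
          k ^ 2 / d * ‖∫ x in 0..d, M x‖ ^ 2) := by
        gcongr
        linarith
      _ = _ := by
        field_simp
  linarith

/-- The part of the pencil below the diagonal and outside the corner square. -/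
def lowerStrip (d : ℝ) : Set (ℝ × ℝ) := {p | d < p.1 ∧ p.2 < p.1 ∧ p.1 - p.2 ≤ d}

lemma measurableSet_lowerStrip (d : ℝ) : MeasurableSet (lowerStrip d) :=
  (measurableSet_lt measurable_const measurable_fst).inter
    ((measurableSet_lt measurable_snd measurable_fst).inter
      (measurableSet_le (measurable_fst.sub measurable_snd) measurable_const))

/-- Integration along the lines `x + y = s`. -/
lemma lintegral_shear {F : ℝ × ℝ → ENNReal} (hF : Measurable F) :
    ∫⁻ p, F p = ∫⁻ s, ∫⁻ y, F (s - y, y) := by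
  have h := measurePreserving_sub_prod (volume : Measure ℝ) (volume : Measure ℝ)
  rw [Measure.volume_eq_prod, ← h.lintegral_comp hF,
    lintegral_prod (fun z : ℝ × ℝ => F (z.1 - z.2, z.2)) (hF.comp h.measurable).aemeasurable]

lemma setLIntegral_lowerStrip {F : ℝ × ℝ → ENNReal} (hF : Measurable F) (d : ℝ) :
    ∫⁻ p in lowerStrip d, F p =
      ∫⁻ s, ∫⁻ y in Set.Ico ((s - d) / 2) (min (s / 2) (s - d)), F (s - y, y) := by
  rw [← lintegral_indicator (measurableSet_lowerStrip d),
    lintegral_shear (hF.indicator (measurableSet_lowerStrip d))]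
  refine lintegral_congr fun s => ?_
  rw [← lintegral_indicator measurableSet_Ico]
  refine lintegral_congr fun y => ?_
  have h : ((s - y, y) : ℝ × ℝ) ∈ lowerStrip d ↔
      y ∈ Set.Ico ((s - d) / 2) (min (s / 2) (s - d)) := by
    simp only [lowerStrip, Set.mem_ofPred_eq, Set.mem_Ico, lt_min_iff]
    constructor
    · rintro ⟨h1, h2, h3⟩
      refine ⟨?_, ?_, ?_⟩ <;> linarith
    · rintro ⟨h1, h2, h3⟩
      refine ⟨?_, ?_, ?_⟩ <;> linarith
  by_cases hy : y ∈ Set.Ico ((s - d) / 2) (min (s / 2) (s - d))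
  · rw [Set.indicator_of_mem hy, Set.indicator_of_mem (h.2 hy)]
  · rw [Set.indicator_of_notMem hy, Set.indicator_of_notMem (mt h.1 hy)]

/-- The slice `x + y = s` ends at the wall point `((s + d) / 2, (s - d) / 2)`, that is `(t + d, t)`
with `t = (s - d) / 2`. -/
lemma lintegral_wall {F : ℝ × ℝ → ENNReal} (hF : Measurable F) (d : ℝ) :
    ∫⁻ s in Set.Ici d, F ((s + d) / 2, (s - d) / 2) =
      2 * ∫⁻ t in Set.Ici (0 : ℝ), F (t + d, t) := by
  have h1 : ∀ s : ℝ, (Set.Ici d).indicator (fun s => F ((s + d) / 2, (s - d) / 2)) s =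
      (Set.Ici (0 : ℝ)).indicator (fun t => F (t + d, t)) (2⁻¹ * (s - d)) := by
    intro s
    have e1 : 2⁻¹ * (s - d) + d = (s + d) / 2 := by ring
    have e2 : 2⁻¹ * (s - d) = (s - d) / 2 := by ring
    by_cases hs : d ≤ s
    · rw [Set.indicator_of_mem (Set.mem_Ici.2 hs), Set.indicator_of_mem
        (Set.mem_Ici.2 (by linarith)), e1, e2]
    · rw [Set.indicator_of_notMem (by simpa using hs), Set.indicator_of_notMem
        (by simp only [Set.mem_Ici]; linarith)]
  have hm : Measurable ((Set.Ici (0 : ℝ)).indicator (fun t => F (t + d, t))) :=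
    (hF.comp (by fun_prop)).indicator measurableSet_Ici
  rw [← lintegral_indicator measurableSet_Ici, ← lintegral_indicator measurableSet_Ici]
  simp only [h1]
  rw [lintegral_sub_right_eq_self
    (fun s => (Set.Ici (0 : ℝ)).indicator (fun t => F (t + d, t)) (2⁻¹ * s)) d,
    ← lintegral_map hm (by fun_prop : Measurable fun s : ℝ => 2⁻¹ * s),
    Real.map_volume_mul_left (by norm_num), lintegral_smul_measure]
  simp

/-- Friedrichs' inequality in the transverse direction, on one side of the diagonal. The transverse
derivative `∂_y - ∂_x` accounts for the factor `2`. -/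
lemma friedrichs_lowerStrip {φ : ℝ × ℝ → ℂ} (h : IsSmoothCompact φ) {d k : ℝ} (hd : 0 < d)
    (hk : 0 < k) (hkd : k * d < Real.pi) :
    ENNReal.ofReal (k ^ 2 / 2) * ∫⁻ p in lowerStrip d, ‖φ p‖ₑ ^ 2 ≤
      (∫⁻ p in lowerStrip d, (‖fderiv ℝ φ p (1, 0)‖ₑ ^ 2 + ‖fderiv ℝ φ p (0, 1)‖ₑ ^ 2)) +
      ENNReal.ofReal (k * Real.tan (k * (d / 2))) *
        ∫⁻ t in Set.Ici (0 : ℝ), ‖φ (t + d, t)‖ₑ ^ 2 := by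
  have c0 : Continuous φ := h.1.continuous
  have c1 : Continuous (fun p => fderiv ℝ φ p (1, 0)) := continuous_partial h.1 _
  have c2 : Continuous (fun p => fderiv ℝ φ p (0, 1)) := continuous_partial h.1 _
  have m0 : Measurable fun p => ‖φ p‖ₑ ^ 2 := (c0.measurable.enorm).pow_const 2
  have m1 : Measurable fun p => ‖fderiv ℝ φ p (1, 0)‖ₑ ^ 2 + ‖fderiv ℝ φ p (0, 1)‖ₑ ^ 2 :=
    (c1.measurable.enorm.pow_const 2).add (c2.measurable.enorm.pow_const 2)
  set T := k * Real.tan (k * (d / 2)) with hT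
  have hT0 : 0 ≤ T := mul_nonneg hk.le
    (Real.tan_nonneg_of_nonneg_of_le_pi_div_two (by positivity) (by linarith))
  rw [setLIntegral_lowerStrip m0, setLIntegral_lowerStrip m1]
  have hw := lintegral_wall m0 d
  have slice : ∀ s, ENNReal.ofReal (k ^ 2 / 2) *
      ∫⁻ y in Set.Ico ((s - d) / 2) (min (s / 2) (s - d)), ‖φ (s - y, y)‖ₑ ^ 2 ≤
      (∫⁻ y in Set.Ico ((s - d) / 2) (min (s / 2) (s - d)),
        (‖fderiv ℝ φ (s - y, y) (1, 0)‖ₑ ^ 2 + ‖fderiv ℝ φ (s - y, y) (0, 1)‖ₑ ^ 2)) +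
      ENNReal.ofReal (T / 2) * (Set.Ici d).indicator
        (fun s => ‖φ ((s + d) / 2, (s - d) / 2)‖ₑ ^ 2) s := by
    intro s
    set a := (s - d) / 2 with ha
    set b := min (s / 2) (s - d) with hb
    rcases le_or_gt b a with hba | hab
    · simp [Set.Ico_eq_empty (not_lt.2 hba)]
    have hsd : d ≤ s := by
      have := hab.trans_le (min_le_right _ _)
      linarith
    have hbl : b - a ≤ d / 2 := by
      have : b ≤ s / 2 := min_le_left _ _
      linarith
    rw [Set.indicator_of_mem (Set.mem_Ici.2 hsd)]
    have hf : ∀ y, HasDerivAt (fun y => φ (s - y, y)) (fderiv ℝ φ (s - y, y) (-1, 1)) y := fun y =>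
      hasDerivAt_slice h (((hasDerivAt_id y).const_sub s).prodMk (hasDerivAt_id y))
    have cc : Continuous fun y : ℝ => ((s - y, y) : ℝ × ℝ) := by fun_prop
    have hf'c := (continuous_partial h.1 (-1, 1)).comp cc
    have h1 := friedrichs_left hf hf'c hab.le hk hbl (by linarith)
    have int : ∀ g : ℝ × ℝ → ℂ, Continuous g →
        IntegrableOn (fun y => ‖g (s - y, y)‖ ^ 2) (Set.Ioc a b) := fun g hg =>
      (intervalIntegrable_iff_integrableOn_Ioc_of_le hab.le).1
        (((hg.comp cc).norm.pow 2).intervalIntegrable _ _)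
    have i1 := int _ c1
    have i2 := int _ c2
    -- `|∂_y φ - ∂_x φ|² ≤ 2 |∇φ|²`
    have h2 : ∫ y in a..b, ‖fderiv ℝ φ (s - y, y) (-1, 1)‖ ^ 2 ≤
        2 * ∫ y in a..b, (‖fderiv ℝ φ (s - y, y) (1, 0)‖ ^ 2 +
          ‖fderiv ℝ φ (s - y, y) (0, 1)‖ ^ 2) := by
      rw [← intervalIntegral.integral_const_mul]
      refine intervalIntegral.integral_mono_on hab.le ((hf'c.norm.pow 2).intervalIntegrable _ _)
        (((((c1.comp cc).norm.pow 2).add ((c2.comp cc).norm.pow 2)).const_mul 2).intervalIntegrable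
          _ _) fun y _ => ?_
      have e1 : ((-1, 1) : ℝ × ℝ) = (0, 1) - (1, 0) := by ext <;> simp
      rw [e1, map_sub]
      have h3 := parallelogram_law_with_norm ℝ (fderiv ℝ φ (s - y, y) (0, 1))
        (fderiv ℝ φ (s - y, y) (1, 0))
      nlinarith [sq_nonneg ‖fderiv ℝ φ (s - y, y) (0, 1) + fderiv ℝ φ (s - y, y) (1, 0)‖]
    have h3 : k ^ 2 / 2 * ∫ y in a..b, ‖φ (s - y, y)‖ ^ 2 ≤
        (∫ y in a..b, (‖fderiv ℝ φ (s - y, y) (1, 0)‖ ^ 2 +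
          ‖fderiv ℝ φ (s - y, y) (0, 1)‖ ^ 2)) + T / 2 * ‖φ (s - a, a)‖ ^ 2 := by
      linarith
    have e2 : s - a = (s + d) / 2 := by rw [ha]; ring
    rw [e2] at h3
    rw [setLIntegral_congr Ico_ae_eq_Ioc, setLIntegral_congr Ico_ae_eq_Ioc,
      lintegral_enorm_sq (int _ c0), lintegral_add_left' (by fun_prop),
      lintegral_enorm_sq i1, lintegral_enorm_sq i2, enorm_sq_eq_ofReal,
      ← ENNReal.ofReal_mul (by positivity), ← ENNReal.ofReal_mul (by positivity),
      ← ENNReal.ofReal_add (by positivity) (by positivity), ← integral_add i1 i2,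
      ← ENNReal.ofReal_add (by positivity) (by positivity)]
    rw [intervalIntegral.integral_of_le hab.le, intervalIntegral.integral_of_le hab.le] at h3
    exact ENNReal.ofReal_le_ofReal h3
  have mi : Measurable ((Set.Ici d).indicator
      (fun s => ‖φ ((s + d) / 2, (s - d) / 2)‖ₑ ^ 2)) :=
    (m0.comp (by fun_prop : Measurable fun s : ℝ => ((s + d) / 2, (s - d) / 2))).indicator
      measurableSet_Ici
  calc _ = ∫⁻ s, ENNReal.ofReal (k ^ 2 / 2) *
      ∫⁻ y in Set.Ico ((s - d) / 2) (min (s / 2) (s - d)), ‖φ (s - y, y)‖ₑ ^ 2 := by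
        rw [lintegral_const_mul' _ _ ENNReal.ofReal_ne_top]
    _ ≤ _ := lintegral_mono slice
    _ = _ := by
        rw [lintegral_add_right _ (mi.const_mul _), lintegral_const_mul _ mi,
          lintegral_indicator measurableSet_Ici, hw, ← mul_assoc]
        congr 2
        rw [show (2 : ENNReal) = ENNReal.ofReal 2 by simp, ← ENNReal.ofReal_mul (by positivity)]
        congr 1
        ring

end Regions

/-! ### The spectral gap on a hyperplane -/

section Gap

/-- The mirror image of `lowerStrip d` in the diagonal. -/
def upperStrip (d : ℝ) : Set (ℝ × ℝ) := Prod.swap ⁻¹' lowerStrip d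

lemma measurableSet_upperStrip (d : ℝ) : MeasurableSet (upperStrip d) :=
  measurable_swap (measurableSet_lowerStrip d)

lemma IsSmoothCompact.comp_swap {φ : ℝ × ℝ → ℂ} (h : IsSmoothCompact φ) :
    IsSmoothCompact (fun p => φ p.swap) :=
  ⟨h.1.comp (contDiff_snd.prodMk contDiff_fst),
    h.2.comp_homeomorph (Homeomorph.prodComm ℝ ℝ)⟩

lemma IsSmoothCompact.fderiv_comp_swap {φ : ℝ × ℝ → ℂ} (h : IsSmoothCompact φ) (p e : ℝ × ℝ) :
    fderiv ℝ (fun p => φ p.swap) p e = fderiv ℝ φ p.swap e.swap := by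
  have h1 : HasFDerivAt (fun p : ℝ × ℝ => p.swap)
      ((ContinuousLinearMap.snd ℝ ℝ ℝ).prod (ContinuousLinearMap.fst ℝ ℝ ℝ)) p :=
    ((ContinuousLinearMap.snd ℝ ℝ ℝ).prod (ContinuousLinearMap.fst ℝ ℝ ℝ)).hasFDerivAt
  have h2 := ((h.1.differentiable (by simp) p.swap).hasFDerivAt).comp p h1
  have h3 : fderiv ℝ (fun p => φ p.swap) p = _ := h2.fderiv
  rw [h3]
  rfl

lemma setLIntegral_lowerStrip_swap {F : ℝ × ℝ → ENNReal} (hF : Measurable F) (d : ℝ) :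
    ∫⁻ p in lowerStrip d, F p.swap = ∫⁻ p in upperStrip d, F p :=
  (Measure.measurePreserving_swap (μ := (volume : Measure ℝ))
    (ν := (volume : Measure ℝ))).setLIntegral_comp_preimage (measurableSet_upperStrip d) hF

lemma friedrichs_upperStrip {φ : ℝ × ℝ → ℂ} (h : IsSmoothCompact φ) {d k : ℝ} (hd : 0 < d)
    (hk : 0 < k) (hkd : k * d < Real.pi) :
    ENNReal.ofReal (k ^ 2 / 2) * ∫⁻ p in upperStrip d, ‖φ p‖ₑ ^ 2 ≤
      (∫⁻ p in upperStrip d, (‖fderiv ℝ φ p (1, 0)‖ₑ ^ 2 + ‖fderiv ℝ φ p (0, 1)‖ₑ ^ 2)) +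
      ENNReal.ofReal (k * Real.tan (k * (d / 2))) *
        ∫⁻ t in Set.Ici (0 : ℝ), ‖φ (t, t + d)‖ₑ ^ 2 := by
  have c0 : Continuous φ := h.1.continuous
  have c1 : Continuous (fun p => fderiv ℝ φ p (1, 0)) := continuous_partial h.1 _
  have c2 : Continuous (fun p => fderiv ℝ φ p (0, 1)) := continuous_partial h.1 _
  have m0 : Measurable fun p => ‖φ p‖ₑ ^ 2 := (c0.measurable.enorm).pow_const 2
  have m1 : Measurable fun p => ‖fderiv ℝ φ p (0, 1)‖ₑ ^ 2 + ‖fderiv ℝ φ p (1, 0)‖ₑ ^ 2 :=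
    (c2.measurable.enorm.pow_const 2).add (c1.measurable.enorm.pow_const 2)
  have key := friedrichs_lowerStrip h.comp_swap hd hk hkd
  simp only [h.fderiv_comp_swap, Prod.swap_prod_mk] at key
  rw [setLIntegral_lowerStrip_swap m0, setLIntegral_lowerStrip_swap m1] at key
  simpa only [add_comm (‖fderiv ℝ φ _ (1, 0)‖ₑ ^ 2)] using key

lemma ae_fst_ne_snd : ∀ᵐ p : ℝ × ℝ, p.1 ≠ p.2 := by
  have hm : MeasurableSet {p : ℝ × ℝ | p.1 = p.2} :=
    measurableSet_eq_fun measurable_fst measurable_snd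
  rw [ae_iff]
  simp only [ne_eq, not_not]
  rw [Measure.volume_eq_prod, Measure.measure_prod_null hm]
  refine ae_of_all _ fun x => ?_
  have : Prod.mk x ⁻¹' {p : ℝ × ℝ | p.1 = p.2} = {x} := by
    ext y
    simp [eq_comm]
  change volume (Prod.mk x ⁻¹' {p : ℝ × ℝ | p.1 = p.2}) = 0
  rw [this]
  simp

lemma cornerSquare_subset_pencil (d : ℝ) : cornerSquare d ⊆ pencil d := by
  rintro ⟨x, y⟩ ⟨⟨h1, h2⟩, h3, h4⟩
  simp only at h1 h2 h3 h4
  exact ⟨h1, h3, abs_le.2 ⟨by simp only; linarith, by simp only; linarith⟩⟩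

lemma setLIntegral_pencil_le (F : ℝ × ℝ → ENNReal) (d : ℝ) :
    ∫⁻ p in pencil d, F p ≤ (∫⁻ p in cornerSquare d, F p) + (∫⁻ p in lowerStrip d, F p) +
      ∫⁻ p in upperStrip d, F p := by
  have h : pencil d ≤ᵐ[volume] (cornerSquare d ∪ lowerStrip d ∪ upperStrip d : Set (ℝ × ℝ)) := by
    filter_upwards [ae_fst_ne_snd] with p hp
    intro hpΩ
    obtain ⟨h1, h2, h3⟩ := hpΩ
    have h4 := abs_le.1 h3
    rcases lt_or_gt_of_ne hp with h5 | h5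
    · by_cases h6 : p.2 ≤ d
      · exact Or.inl (Or.inl ⟨⟨h1, by linarith⟩, h2, h6⟩)
      · exact Or.inr ⟨not_le.1 h6, h5, by simp only [Prod.fst_swap, Prod.snd_swap]; linarith⟩
    · by_cases h6 : p.1 ≤ d
      · exact Or.inl (Or.inl ⟨⟨h1, h6⟩, h2, by linarith⟩)
      · exact Or.inl (Or.inr ⟨not_le.1 h6, h5, by linarith⟩)
  calc _ ≤ ∫⁻ p in cornerSquare d ∪ lowerStrip d ∪ upperStrip d, F p := lintegral_mono_set' h
    _ ≤ _ := (lintegral_union_le _ _ _).trans (add_le_add (lintegral_union_le _ _ _) le_rfl)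

lemma le_setLIntegral_pencil (F : ℝ × ℝ → ENNReal) (d : ℝ) :
    (∫⁻ p in cornerSquare d, F p) + (∫⁻ p in lowerStrip d, F p) +
      (∫⁻ p in upperStrip d, F p) ≤ ∫⁻ p in pencil d, F p := by
  have d1 : Disjoint (cornerSquare d) (lowerStrip d) := by
    refine Set.disjoint_left.2 ?_
    rintro p ⟨⟨_, h1⟩, _⟩ ⟨h2, _⟩
    exact absurd h1 (not_le.2 h2)
  have d2 : Disjoint (cornerSquare d ∪ lowerStrip d) (upperStrip d) := by
    refine Set.disjoint_left.2 ?_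
    rintro p (⟨_, ⟨_, h1⟩⟩ | ⟨_, h1, _⟩) ⟨h2, h3, _⟩
    · exact absurd h1 (not_le.2 h2)
    · exact absurd h1 (not_lt.2 (le_of_lt h3))
  have hl : lowerStrip d ⊆ pencil d := by
    rintro p ⟨h1, h2, h3⟩
    have h4 : 0 < p.2 := by linarith
    exact ⟨by linarith, h4.le, abs_le.2 ⟨by linarith, h3⟩⟩
  have hu : upperStrip d ⊆ pencil d := by
    rintro p ⟨h1, h2, h3⟩
    simp only [Prod.fst_swap, Prod.snd_swap] at h1 h2 h3
    have h4 : 0 < p.1 := by linarith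
    exact ⟨h4.le, by linarith, abs_le.2 ⟨by linarith, by linarith⟩⟩
  rw [← lintegral_union (measurableSet_lowerStrip d) d1,
    ← lintegral_union (measurableSet_upperStrip d) d2]
  exact lintegral_mono_set
    (Set.union_subset (Set.union_subset (cornerSquare_subset_pencil d) hl) hu)

/-- The lower bound `k² / 2` for the form, up to the boundary values on the walls and the integral
over the corner square. -/
lemma pencil_inequality {φ : ℝ × ℝ → ℂ} (h : IsSmoothCompact φ) {d k : ℝ} (hd : 0 < d)
    (hk : 0 < k) (hkd : k * d < Real.pi) :
    ENNReal.ofReal (k ^ 2 / 2) * eLpNorm φ 2 (volume.restrict (pencil d)) ^ 2 ≤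
      eLpNorm (fun p => fderiv ℝ φ p (1, 0)) 2 (volume.restrict (pencil d)) ^ 2 +
      eLpNorm (fun p => fderiv ℝ φ p (0, 1)) 2 (volume.restrict (pencil d)) ^ 2 +
      ENNReal.ofReal (k ^ 2 / d ^ 2) * ‖∫ p in cornerSquare d, φ p‖ₑ ^ 2 +
      ENNReal.ofReal (k * Real.tan (k * (d / 2))) * eLpNorm φ 2 (wallMeasure d) ^ 2 := by
  have c0 : Continuous φ := h.1.continuous
  have c1 : Continuous (fun p => fderiv ℝ φ p (1, 0)) := continuous_partial h.1 _
  have c2 : Continuous (fun p => fderiv ℝ φ p (0, 1)) := continuous_partial h.1 _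
  have m0 : Measurable fun p => ‖φ p‖ₑ ^ 2 := (c0.measurable.enorm).pow_const 2
  have m1 : Measurable fun p => ‖fderiv ℝ φ p (1, 0)‖ₑ ^ 2 := c1.measurable.enorm.pow_const 2
  simp only [eLpNorm_two_sq]
  have hwall : ∫⁻ p, ‖φ p‖ₑ ^ 2 ∂(wallMeasure d) =
      (∫⁻ t in Set.Ici (0 : ℝ), ‖φ (t + d, t)‖ₑ ^ 2) +
        ∫⁻ t in Set.Ici (0 : ℝ), ‖φ (t, t + d)‖ₑ ^ 2 := by
    rw [wallMeasure, lintegral_add_measure, lintegral_map m0 (by fun_prop),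
      lintegral_map m0 (by fun_prop)]
  have hQ : ENNReal.ofReal (k ^ 2 / 2) * ∫⁻ p in cornerSquare d, ‖φ p‖ₑ ^ 2 ≤
      (∫⁻ p in cornerSquare d, (‖fderiv ℝ φ p (1, 0)‖ₑ ^ 2 + ‖fderiv ℝ φ p (0, 1)‖ₑ ^ 2)) +
      ENNReal.ofReal (k ^ 2 / d ^ 2) * ‖∫ p in cornerSquare d, φ p‖ₑ ^ 2 := by
    have int : ∀ g : ℝ × ℝ → ℂ, Continuous g → IntegrableOn (fun p => ‖g p‖ ^ 2) (cornerSquare d) :=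
      fun g hg => (continuous_norm_sq hg).continuousOn.integrableOn_compact
        (isCompact_cornerSquare d)
    rw [lintegral_add_left m1, lintegral_enorm_sq (int _ c0), lintegral_enorm_sq (int _ c1),
      lintegral_enorm_sq (int _ c2), enorm_sq_eq_ofReal, ← ENNReal.ofReal_mul (by positivity),
      ← ENNReal.ofReal_mul (by positivity), ← ENNReal.ofReal_add (by positivity) (by positivity),
      ← ENNReal.ofReal_add (by positivity) (by positivity)]
    refine ENNReal.ofReal_le_ofReal ?_
    have h1 := wirtinger_cornerSquare h hd hk hkd
    have h2 : 0 ≤ k ^ 2 * ∫ p in cornerSquare d, ‖φ p‖ ^ 2 := by positivity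
    linarith
  have hL := friedrichs_lowerStrip h hd hk hkd
  have hU := friedrichs_upperStrip h hd hk hkd
  rw [hwall]
  have hsum := add_le_add (add_le_add hQ hL) hU
  rw [← mul_add, ← mul_add] at hsum
  have hgrad := le_setLIntegral_pencil
    (fun p => ‖fderiv ℝ φ p (1, 0)‖ₑ ^ 2 + ‖fderiv ℝ φ p (0, 1)‖ₑ ^ 2) d
  have e := lintegral_add_left (μ := volume.restrict (pencil d)) m1
    (fun p => ‖fderiv ℝ φ p (0, 1)‖ₑ ^ 2)
  rw [← e]
  refine (mul_le_mul_right (setLIntegral_pencil_le _ d) _).trans (hsum.trans ?_)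
  refine le_trans (le_of_eq ?_) (add_le_add (add_le_add hgrad le_rfl) le_rfl)
  ring

/-- The indicator function of the corner square in `L²(Ω)`. -/
def cornerVector (d : ℝ) : L2 (pencil d) :=
  indicatorConstLp 2 (isCompact_cornerSquare d).measurableSet
    (Measure.restrict_apply_le _ _ |>.trans_lt (isCompact_cornerSquare d).measure_lt_top).ne (1 : ℂ)

lemma inner_cornerVector {d : ℝ} {φ : ℝ × ℝ → ℂ}
    (h : MemLp φ 2 ((volume : Measure (ℝ × ℝ)).restrict (pencil d))) :
    inner ℂ (cornerVector d) h.toLp = ∫ p in cornerSquare d, φ p := by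
  rw [cornerVector, L2.inner_indicatorConstLp_one,
    Measure.restrict_restrict (isCompact_cornerSquare d).measurableSet,
    Set.inter_eq_left.2 (cornerSquare_subset_pencil d)]
  exact integral_congr_ae (ae_restrict_of_ae_restrict_of_subset (cornerSquare_subset_pencil d)
    h.coeFn_toLp)

lemma tendsto_toLp {Ω : Set (ℝ × ℝ)} {f : ℕ → ℝ × ℝ → ℂ}
    (hf : ∀ n, MemLp (f n) 2 ((volume : Measure (ℝ × ℝ)).restrict Ω)) {u : L2 Ω}
    (h : Tendsto (fun n => eLpNorm (fun p => f n p - u p) 2 (volume.restrict Ω)) atTop (𝓝 0)) :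
    Tendsto (fun n => (hf n).toLp) atTop (𝓝 u) := by
  have h1 := (Lp.tendsto_Lp_iff_tendsto_eLpNorm'' f hf u (Lp.memLp u)).2 h
  rwa [Lp.toLp_coeFn] at h1

lemma tendsto_eLpNorm {Ω : Set (ℝ × ℝ)} {f : ℕ → ℝ × ℝ → ℂ}
    (hf : ∀ n, MemLp (f n) 2 ((volume : Measure (ℝ × ℝ)).restrict Ω)) {u : L2 Ω}
    (h : Tendsto (fun n => eLpNorm (fun p => f n p - u p) 2 (volume.restrict Ω)) atTop (𝓝 0)) :
    Tendsto (fun n => eLpNorm (f n) 2 (volume.restrict Ω) ^ 2) atTop (𝓝 (‖u‖ₑ ^ 2)) := by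
  have h1 := ((ENNReal.continuous_pow 2).tendsto _).comp ((tendsto_toLp hf h).enorm)
  simpa only [Lp.enorm_toLp, Function.comp_def] using h1

lemma norm_gradient_sq {d : ℝ} (u : formDomain d) :
    ‖gradient d u‖ ^ 2 = ‖(gradient d u).fst‖ ^ 2 + ‖(gradient d u).snd‖ ^ 2 :=
  WithLp.prod_norm_sq_eq_of_L2 _

/-- For `k < π / d` the constant in front of the wall term is finite, so that term vanishes in the
limit of smooth approximations. -/
lemma le_norm_gradient_sq_of_lt {d k : ℝ} (hd : 0 < d) (hk : 0 < k) (hkd : k * d < Real.pi)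
    (u : formDomain d) (hu : inner ℂ (cornerVector d) (u : L2 (pencil d)) = 0) :
    k ^ 2 / 2 * ‖(u : L2 (pencil d))‖ ^ 2 ≤ ‖gradient d u‖ ^ 2 := by
  obtain ⟨φ, h0, h1, h2, h3, h4⟩ := exists_approx u
  have t1 := tendsto_eLpNorm (fun n => (h0 n).memLp _) h1
  have t2 := tendsto_eLpNorm (fun n => (h0 n).memLp_partial _ _) h2
  have t3 := tendsto_eLpNorm (fun n => (h0 n).memLp_partial _ _) h3
  have t4 : Tendsto (fun n => eLpNorm (φ n) 2 (wallMeasure d) ^ 2) atTop (𝓝 0) := by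
    have := ((ENNReal.continuous_pow 2).tendsto _).comp h4
    simpa [Function.comp_def] using this
  have t5 : Tendsto (fun n => ‖∫ p in cornerSquare d, φ n p‖ₑ ^ 2) atTop (𝓝 0) := by
    have h5 : Tendsto (fun n => inner ℂ (cornerVector d) ((h0 n).memLp (pencil d)).toLp) atTop
        (𝓝 0) := by
      rw [← hu]
      exact ((by fun_prop : Continuous fun w : L2 (pencil d) =>
        inner ℂ (cornerVector d) w).tendsto _).comp (tendsto_toLp (fun n => (h0 n).memLp _) h1)
    simp only [inner_cornerVector] at h5
    have := ((ENNReal.continuous_pow 2).tendsto _).comp h5.enorm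
    simpa [Function.comp_def] using this
  have hlim := le_of_tendsto_of_tendsto'
    (ENNReal.Tendsto.const_mul t1 (Or.inr ENNReal.ofReal_ne_top))
    (((t2.add t3).add (ENNReal.Tendsto.const_mul t5 (Or.inr ENNReal.ofReal_ne_top))).add
      (ENNReal.Tendsto.const_mul t4 (Or.inr ENNReal.ofReal_ne_top)))
    (fun n => pencil_inequality (h0 n) hd hk hkd)
  simp only [mul_zero, add_zero] at hlim
  rw [norm_gradient_sq]
  have e : ∀ w : L2 (pencil d), ‖w‖ₑ ^ 2 = ENNReal.ofReal (‖w‖ ^ 2) := fun w => by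
    rw [ENNReal.ofReal_pow (norm_nonneg _), ofReal_norm]
  rw [e, e, e, ← ENNReal.ofReal_mul (by positivity),
    ← ENNReal.ofReal_add (by positivity) (by positivity)] at hlim
  exact (ENNReal.ofReal_le_ofReal_iff (by positivity)).1 hlim

/-- The spectral gap: on the hyperplane of functions with mean zero over the corner square the form
is bounded below by the threshold `π² / (2d²)`. -/
lemma le_norm_gradient_sq {d : ℝ} (hd : 0 < d) (u : formDomain d)
    (hu : inner ℂ (cornerVector d) (u : L2 (pencil d)) = 0) :
    Real.pi ^ 2 / (2 * d ^ 2) * ‖(u : L2 (pencil d))‖ ^ 2 ≤ ‖gradient d u‖ ^ 2 := by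
  have h1 : Tendsto (fun k : ℝ => k ^ 2 / 2 * ‖(u : L2 (pencil d))‖ ^ 2) (𝓝[<] (Real.pi / d))
      (𝓝 ((Real.pi / d) ^ 2 / 2 * ‖(u : L2 (pencil d))‖ ^ 2)) :=
    ((by fun_prop : Continuous fun k : ℝ => k ^ 2 / 2 * ‖(u : L2 (pencil d))‖ ^ 2).tendsto
      _).mono_left nhdsWithin_le_nhds
  have h2 : ∀ᶠ k in 𝓝[<] (Real.pi / d), 0 < k :=
    eventually_nhdsWithin_of_eventually_nhds (lt_mem_nhds (by positivity))
  have h3 := le_of_tendsto h1 (by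
    filter_upwards [h2, self_mem_nhdsWithin] with k hk hk'
    exact le_norm_gradient_sq_of_lt hd hk ((lt_div_iff₀ hd).1 hk') u hu)
  have h4 : Real.pi ^ 2 / (2 * d ^ 2) = (Real.pi / d) ^ 2 / 2 := by field_simp
  rwa [h4]

end Gap

/-! ### The trial function -/

section Trial

/-- A smooth cutoff on the line, equal to `1` on `[-1, 1]` and supported in `[-2, 2]`. -/
def cutoff : ContDiffBump (0 : ℝ) := ⟨1, 2, one_pos, one_lt_two⟩

lemma cutoff_eq_one {t : ℝ} (ht : |t| ≤ 1) : cutoff t = 1 :=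
  cutoff.one_of_mem_closedBall (by simpa [cutoff] using ht)

lemma cutoff_eq_zero {t : ℝ} (ht : 2 ≤ |t|) : cutoff t = 0 :=
  cutoff.zero_of_le_dist (by simpa [cutoff] using ht)

lemma deriv_cutoff_eq_zero {t : ℝ} (ht : 2 < |t|) : deriv cutoff t = 0 := by
  have h : (cutoff : ℝ → ℝ) =ᶠ[𝓝 t] fun _ => 0 := by
    filter_upwards [(continuous_abs.tendsto t).eventually (lt_mem_nhds ht)] with s hs
    exact cutoff_eq_zero hs.le
  rw [h.deriv_eq]
  simp

lemma exists_bound_deriv_cutoff : ∃ C, ∀ t, |deriv cutoff t| ≤ C := by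
  have h : Continuous (deriv cutoff) := (cutoff.contDiff (n := 1)).continuous_deriv_one
  exact cutoff.hasCompactSupport.deriv.exists_bound_of_continuous h

lemma hasDerivAt_cutoff (t : ℝ) : HasDerivAt cutoff (deriv cutoff t) t :=
  ((cutoff.contDiff (n := 1)).differentiable (by simp) t).hasDerivAt

/-- The trial function: the transverse ground state `cos (π (x - y) / (2d))`, extended up to the
corner and cut off at `x + y ∼ R`. The last factor equals `1` on the pencil and makes the support
compact. -/
def trial (d R : ℝ) (p : ℝ × ℝ) : ℂ :=
  ((Real.cos (Real.pi / (2 * d) * (p.1 - p.2)) * cutoff ((p.1 + p.2) / R) *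
    cutoff ((p.1 - p.2) / (2 * d)) : ℝ) : ℂ)

lemma isSmoothCompact_trial {d R : ℝ} (hd : 0 < d) (hR : 0 < R) : IsSmoothCompact (trial d R) := by
  constructor
  · refine Complex.ofRealCLM.contDiff.comp ?_
    refine (ContDiff.mul ?_ ?_).mul ?_
    · exact Real.contDiff_cos.comp (by fun_prop)
    · exact cutoff.contDiff.comp (by fun_prop)
    · exact cutoff.contDiff.comp (by fun_prop)
  · refine HasCompactSupport.intro (K := Set.Icc (-(R + 2 * d)) (R + 2 * d) ×ˢ
      Set.Icc (-(R + 2 * d)) (R + 2 * d)) (isCompact_Icc.prod isCompact_Icc) fun p hp => ?_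
    by_contra hne
    refine hp ?_
    have h1 : |(p.1 + p.2) / R| < 2 := by
      by_contra! h
      exact hne (by simp [trial, cutoff_eq_zero h])
    have h2 : |(p.1 - p.2) / (2 * d)| < 2 := by
      by_contra! h
      exact hne (by simp [trial, cutoff_eq_zero h])
    rw [abs_div, abs_of_pos hR, div_lt_iff₀ hR, abs_lt] at h1
    rw [abs_div, abs_of_pos (by positivity : 0 < 2 * d), div_lt_iff₀ (by positivity), abs_lt] at h2
    refine ⟨⟨?_, ?_⟩, ?_, ?_⟩ <;> linarith [h1.1, h1.2, h2.1, h2.2]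

lemma trial_of_mem {d R : ℝ} (hd : 0 < d) {p : ℝ × ℝ} (hp : |p.1 - p.2| ≤ 2 * d) :
    trial d R p =
      ((Real.cos (Real.pi / (2 * d) * (p.1 - p.2)) * cutoff ((p.1 + p.2) / R) : ℝ) : ℂ) := by
  rw [trial, cutoff_eq_one (t := (p.1 - p.2) / (2 * d)), mul_one]
  rw [abs_div, abs_of_pos (by positivity : 0 < 2 * d)]
  exact (div_le_one (by positivity)).2 hp

lemma trial_wall {d R : ℝ} (hd : 0 < d) {p : ℝ × ℝ} (hp : |p.1 - p.2| = |d|) : trial d R p = 0 := by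
  rw [abs_of_pos hd] at hp
  have h : Real.cos (Real.pi / (2 * d) * (p.1 - p.2)) = 0 := by
    rw [← Real.cos_abs, abs_mul, hp, abs_of_pos (by positivity),
      show Real.pi / (2 * d) * d = Real.pi / 2 by field_simp, Real.cos_pi_div_two]
  rw [trial, h]
  simp

lemma fderiv_trial {d R : ℝ} (hd : 0 < d) (hR : 0 < R) {p : ℝ × ℝ} (hp : p ∈ pencil d)
    (e : ℝ × ℝ) :
    fderiv ℝ (trial d R) p e =
      ((-Real.sin (Real.pi / (2 * d) * (p.1 - p.2)) * (Real.pi / (2 * d) * (e.1 - e.2)) *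
          cutoff ((p.1 + p.2) / R) +
        Real.cos (Real.pi / (2 * d) * (p.1 - p.2)) *
          (deriv cutoff ((p.1 + p.2) / R) * ((e.1 + e.2) / R)) : ℝ) : ℂ) := by
  set c := Real.pi / (2 * d) with hc
  have hline : HasDerivAt (fun t : ℝ => p + t • e) e 0 := by
    simpa using ((hasDerivAt_id (0 : ℝ)).smul_const e).const_add p
  have hl1 : HasDerivAt (fun t : ℝ => (p + t • e).1) e.1 0 := by
    simpa using ((hasDerivAt_id (0 : ℝ)).mul_const e.1).const_add p.1
  have hl2 : HasDerivAt (fun t : ℝ => (p + t • e).2) e.2 0 := by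
    simpa using ((hasDerivAt_id (0 : ℝ)).mul_const e.2).const_add p.2
  have h1 : HasDerivAt (fun t : ℝ => trial d R (p + t • e)) (fderiv ℝ (trial d R) p e) 0 := by
    have := hasDerivAt_slice (isSmoothCompact_trial hd hR) hline
    simpa using this
  have h2 : HasDerivAt (fun t : ℝ => Real.cos (c * ((p + t • e).1 - (p + t • e).2)))
      (-Real.sin (c * (p.1 - p.2)) * (c * (e.1 - e.2))) 0 := by
    have h3 : HasDerivAt (fun t : ℝ => c * ((p + t • e).1 - (p + t • e).2)) (c * (e.1 - e.2)) 0 :=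
      (hl1.sub hl2).const_mul c
    simpa using h3.cos
  have h4 : HasDerivAt (fun t : ℝ => cutoff (((p + t • e).1 + (p + t • e).2) / R))
      (deriv cutoff ((p.1 + p.2) / R) * ((e.1 + e.2) / R)) 0 := by
    have h5 : HasDerivAt (fun t : ℝ => ((p + t • e).1 + (p + t • e).2) / R) ((e.1 + e.2) / R) 0 :=
      (hl1.add hl2).div_const R
    have h6 := (hasDerivAt_cutoff (((p + (0 : ℝ) • e).1 + (p + (0 : ℝ) • e).2) / R)).comp 0 h5
    simpa [Function.comp_def] using h6
  have h7 := (h2.mul h4).ofReal_comp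
  have hnear : (fun t : ℝ => trial d R (p + t • e)) =ᶠ[𝓝 0] fun t =>
      ((Real.cos (c * ((p + t • e).1 - (p + t • e).2)) *
        cutoff (((p + t • e).1 + (p + t • e).2) / R) : ℝ) : ℂ) := by
    have hcont : Continuous fun t : ℝ => |(p + t • e).1 - (p + t • e).2| := by fun_prop
    have h8 : |(p + (0 : ℝ) • e).1 - (p + (0 : ℝ) • e).2| < 2 * d := by
      have := hp.2.2
      simp only [zero_smul, add_zero]
      linarith
    filter_upwards [hcont.continuousAt.eventually (gt_mem_nhds h8)] with t ht
    exact trial_of_mem hd ht.le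
  have h9 := h1.unique (h7.congr_of_eventuallyEq hnear)
  rw [h9]
  simp

/-- The integrand of the form minus the threshold at the trial function. -/
def trialDensity (d R : ℝ) (p : ℝ × ℝ) : ℝ :=
  2 * Real.cos (Real.pi / (2 * d) * (p.1 - p.2)) ^ 2 * (deriv cutoff ((p.1 + p.2) / R) / R) ^ 2 -
    2 * (Real.pi / (2 * d)) ^ 2 * Real.cos (Real.pi / d * (p.1 - p.2)) *
      cutoff ((p.1 + p.2) / R) ^ 2

lemma trialDensity_eq {d R : ℝ} (hd : 0 < d) (hR : 0 < R) {p : ℝ × ℝ} (hp : p ∈ pencil d) :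
    ‖fderiv ℝ (trial d R) p (1, 0)‖ ^ 2 + ‖fderiv ℝ (trial d R) p (0, 1)‖ ^ 2 -
      Real.pi ^ 2 / (2 * d ^ 2) * ‖trial d R p‖ ^ 2 = trialDensity d R p := by
  have h1 : Real.cos (Real.pi / d * (p.1 - p.2)) =
      2 * Real.cos (Real.pi / (2 * d) * (p.1 - p.2)) ^ 2 - 1 := by
    rw [← Real.cos_two_mul]
    congr 1
    field_simp
  have h2 : Real.pi ^ 2 / (2 * d ^ 2) = 2 * (Real.pi / (2 * d)) ^ 2 := by field_simp
  have h3 : |p.1 - p.2| ≤ 2 * d := by linarith [hp.2.2]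
  rw [fderiv_trial hd hR hp, fderiv_trial hd hR hp, trial_of_mem hd h3, Complex.norm_real,
    Complex.norm_real, Complex.norm_real, Real.norm_eq_abs, Real.norm_eq_abs, Real.norm_eq_abs,
    sq_abs, sq_abs, sq_abs, trialDensity, h1, h2]
  have h4 := Real.sin_sq (Real.pi / (2 * d) * (p.1 - p.2))
  simp only [sub_zero, add_zero, zero_sub, zero_add]
  linear_combination (2 * (Real.pi / (2 * d)) ^ 2 * cutoff ((p.1 + p.2) / R) ^ 2) * h4

lemma isClosed_pencil (d : ℝ) : IsClosed (pencil d) := by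
  refine (isClosed_le continuous_const continuous_fst).inter
    ((isClosed_le continuous_const continuous_snd).inter
      (isClosed_le (continuous_fst.sub continuous_snd).abs continuous_const))

/-- The section of the pencil by the line `x + y = s`. -/
lemma mem_pencil_slice {d s y : ℝ} : (s - y, y) ∈ pencil d ↔
    y ∈ Set.Icc (max 0 ((s - d) / 2)) (s - max 0 ((s - d) / 2)) := by
  have h1 : y ≤ s - max 0 ((s - d) / 2) ↔ 0 ≤ s - y ∧ (s - d) / 2 ≤ s - y := by
    rw [← max_le_iff]
    constructor <;> intro h <;> linarith
  rw [Set.mem_Icc, max_le_iff, h1]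
  simp only [pencil, Set.mem_ofPred_eq, abs_le]
  constructor
  · rintro ⟨h2, h3, h4, h5⟩
    refine ⟨⟨?_, ?_⟩, ?_, ?_⟩ <;> linarith
  · rintro ⟨⟨h2, h3⟩, h4, h5⟩
    refine ⟨?_, ?_, ?_, ?_⟩ <;> linarith

lemma integral_shear {F : ℝ × ℝ → ℝ} (hF : Integrable F) :
    Integrable (fun s => ∫ y, F (s - y, y)) ∧ ∫ p, F p = ∫ s, ∫ y, F (s - y, y) := by
  have h := measurePreserving_sub_prod (volume : Measure ℝ) (volume : Measure ℝ)
  have h1 : Integrable (fun z : ℝ × ℝ => F (z.1 - z.2, z.2))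
      ((volume : Measure ℝ).prod volume) := h.integrable_comp_of_integrable hF
  refine ⟨h1.integral_prod_left, ?_⟩
  have h2 : ∫ p, F p = ∫ z, F (z.1 - z.2, z.2) ∂((volume : Measure ℝ).prod volume) := by
    rw [← integral_map h.measurable.aemeasurable (by rw [h.map_eq]; exact hF.aestronglyMeasurable),
      h.map_eq]
    rfl
  rw [h2, integral_prod _ h1]

lemma integral_cos_slice {b c s : ℝ} (hc : c ≠ 0) :
    ∫ y in b..s - b, Real.cos (c * (s - 2 * y)) = Real.sin (c * (s - 2 * b)) / c := by
  have h : ∀ y ∈ Set.uIcc b (s - b),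
      HasDerivAt (fun y => -Real.sin (c * (s - 2 * y)) / (2 * c))
        (Real.cos (c * (s - 2 * y))) y := by
    intro y _
    have h1 : HasDerivAt (fun y => c * (s - 2 * y)) (c * (-(2 * 1))) y :=
      (((hasDerivAt_id y).const_mul 2).const_sub s).const_mul c
    refine (h1.sin.neg.div_const (2 * c)).congr_deriv ?_
    field_simp
  rw [intervalIntegral.integral_eq_sub_of_hasDerivAt h
    ((by fun_prop : Continuous fun y => Real.cos (c * (s - 2 * y))).intervalIntegrable _ _)]
  rw [show c * (s - 2 * (s - b)) = -(c * (s - 2 * b)) by ring, Real.sin_neg]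
  field_simp
  ring

/-- In each slice the threshold term integrates to a non-positive number, which for `s ≤ d`, in the
corner, is `-(π / 2d) sin (π s / d)`. -/
lemma integral_slice_le {d R C : ℝ} (hd : 0 < d) (hdR : d ≤ R) (hC : ∀ t, |deriv cutoff t| ≤ C)
    (s : ℝ) :
    ∫ y, (pencil d).indicator (trialDensity d R) (s - y, y) ≤
      (Set.Icc 0 (2 * R)).indicator (fun _ => 2 * d * (C / R) ^ 2) s -
      (Set.Icc 0 d).indicator (fun s => Real.pi / (2 * d) * Real.sin (Real.pi / d * s)) s := by
  have hR : 0 < R := hd.trans_le hdR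
  set b := max 0 ((s - d) / 2) with hb
  have h1 : ∀ y, (pencil d).indicator (trialDensity d R) (s - y, y) =
      (Set.Icc b (s - b)).indicator (fun y => trialDensity d R (s - y, y)) y := by
    intro y
    by_cases hy : y ∈ Set.Icc b (s - b)
    · rw [Set.indicator_of_mem hy, Set.indicator_of_mem (mem_pencil_slice.2 hy)]
    · rw [Set.indicator_of_notMem hy, Set.indicator_of_notMem (mt mem_pencil_slice.1 hy)]
  simp only [h1]
  rw [integral_indicator measurableSet_Icc]
  have hb0 : 0 ≤ b := le_max_left _ _
  rcases lt_or_ge s 0 with hs | hs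
  · rw [Set.Icc_eq_empty (by linarith), Set.indicator_of_notMem (fun h => absurd h.1 (not_le.2 hs)),
      Set.indicator_of_notMem (fun h => absurd h.1 (not_le.2 hs))]
    simp
  have hbs : b ≤ s - b := by
    have : b ≤ s / 2 := max_le (by linarith) (by linarith)
    linarith
  have hbd : s - b - b ≤ d := by
    have : (s - d) / 2 ≤ b := le_max_right _ _
    linarith
  rw [integral_Icc_eq_integral_Ioc, ← intervalIntegral.integral_of_le hbs]
  set X := cutoff (s / R) with hX
  set X' := deriv cutoff (s / R) / R with hX'
  have h2 : ∀ y, trialDensity d R (s - y, y) =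
      2 * X' ^ 2 * Real.cos (Real.pi / (2 * d) * (s - 2 * y)) ^ 2 -
        2 * (Real.pi / (2 * d)) ^ 2 * X ^ 2 * Real.cos (Real.pi / d * (s - 2 * y)) := by
    intro y
    simp only [trialDensity, sub_add_cancel]
    rw [show s - y - y = s - 2 * y by ring]
    ring
  simp only [h2]
  rw [intervalIntegral.integral_sub (Continuous.intervalIntegrable (by fun_prop) _ _)
    (Continuous.intervalIntegrable (by fun_prop) _ _), intervalIntegral.integral_const_mul,
    intervalIntegral.integral_const_mul, integral_cos_slice (by positivity)]
  have h3 : ∫ y in b..s - b, Real.cos (Real.pi / (2 * d) * (s - 2 * y)) ^ 2 ≤ d := by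
    calc _ ≤ ∫ y in b..s - b, (1 : ℝ) := intervalIntegral.integral_mono_on hbs
          (Continuous.intervalIntegrable (by fun_prop) _ _) (by simp)
          fun y _ => Real.cos_sq_le_one _
      _ = s - b - b := by simp
      _ ≤ d := hbd
  have h4 : 2 * X' ^ 2 * ∫ y in b..s - b, Real.cos (Real.pi / (2 * d) * (s - 2 * y)) ^ 2 ≤
      (Set.Icc 0 (2 * R)).indicator (fun _ => 2 * d * (C / R) ^ 2) s := by
    by_cases hs2 : s ≤ 2 * R
    · rw [Set.indicator_of_mem (Set.mem_Icc.2 ⟨hs, hs2⟩)]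
      have h5 : X' ^ 2 ≤ (C / R) ^ 2 := by
        rw [← sq_abs X', hX', abs_div, abs_of_pos hR]
        gcongr
        exact hC _
      calc _ ≤ 2 * X' ^ 2 * d := by gcongr
        _ ≤ 2 * (C / R) ^ 2 * d := by gcongr
        _ = _ := by ring
    · have h5 : X' = 0 := by
        rw [hX', deriv_cutoff_eq_zero, zero_div]
        rw [abs_div, abs_of_pos hR, lt_div_iff₀ hR]
        exact (not_le.1 hs2).trans_le (le_abs_self s)
      rw [h5, Set.indicator_of_notMem (fun h => hs2 h.2)]
      simp
  have h6 : (Set.Icc 0 d).indicator (fun s => Real.pi / (2 * d) * Real.sin (Real.pi / d * s)) s ≤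
      2 * (Real.pi / (2 * d)) ^ 2 * X ^ 2 *
        (Real.sin (Real.pi / d * (s - 2 * b)) / (Real.pi / d)) := by
    have h7 : 2 * (Real.pi / (2 * d)) ^ 2 * X ^ 2 *
        (Real.sin (Real.pi / d * (s - 2 * b)) / (Real.pi / d)) =
        X ^ 2 * (Real.pi / (2 * d) * Real.sin (Real.pi / d * (s - 2 * b))) := by
      have := Real.pi_pos.ne'
      field_simp
    rw [h7]
    by_cases hsd : s ≤ d
    · have hb' : b = 0 := max_eq_left (by linarith)
      have hX1 : X = 1 := cutoff_eq_one (by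
        rw [abs_div, abs_of_pos hR, abs_of_nonneg hs, div_le_one hR]
        linarith)
      rw [Set.indicator_of_mem (Set.mem_Icc.2 ⟨hs, hsd⟩), hb', hX1]
      simp
    · have hb' : b = (s - d) / 2 := max_eq_right (by linarith)
      rw [Set.indicator_of_notMem (fun h => hsd h.2), hb',
        show Real.pi / d * (s - 2 * ((s - d) / 2)) = Real.pi by field_simp; ring, Real.sin_pi]
      simp
  linarith

lemma integral_pencil_trialDensity_le {d R C : ℝ} (hd : 0 < d) (hdR : d ≤ R)
    (hC : ∀ t, |deriv cutoff t| ≤ C) (hi : IntegrableOn (trialDensity d R) (pencil d)) :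
    ∫ p in pencil d, trialDensity d R p ≤ 4 * d * C ^ 2 / R - 1 := by
  have hR : 0 < R := hd.trans_le hdR
  have hm : MeasurableSet (pencil d) := (isClosed_pencil d).measurableSet
  obtain ⟨h1, h2⟩ := integral_shear ((integrable_indicator_iff hm).2 hi)
  rw [← integral_indicator hm, h2]
  have i1 : Integrable ((Set.Icc 0 (2 * R)).indicator fun _ : ℝ => 2 * d * (C / R) ^ 2) :=
    (integrable_indicator_iff measurableSet_Icc).2
      (continuous_const.integrableOn_Icc)
  have i2 : Integrable ((Set.Icc 0 d).indicator
      fun s => Real.pi / (2 * d) * Real.sin (Real.pi / d * s)) :=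
    (integrable_indicator_iff measurableSet_Icc).2
      ((by fun_prop : Continuous fun s =>
        Real.pi / (2 * d) * Real.sin (Real.pi / d * s)).integrableOn_Icc)
  refine (integral_mono h1 (i1.sub i2) (integral_slice_le hd hdR hC)).trans (le_of_eq ?_)
  simp only [Pi.sub_apply]
  rw [integral_sub i1 i2, integral_indicator measurableSet_Icc,
    integral_indicator measurableSet_Icc,
    integral_Icc_eq_integral_Ioc, integral_Icc_eq_integral_Ioc,
    ← intervalIntegral.integral_of_le (by positivity), ← intervalIntegral.integral_of_le hd.le,
    intervalIntegral.integral_const, intervalIntegral.integral_const_mul,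
    intervalIntegral.integral_comp_mul_left (fun x => Real.sin x) (by positivity),
    integral_sin]
  have h3 : Real.pi / d * d = Real.pi := by field_simp
  rw [h3, mul_zero, Real.cos_zero, Real.cos_pi]
  have := Real.pi_pos.ne'
  simp only [smul_eq_mul]
  field_simp
  ring

/-- The form drops below the threshold on the trial function: the corner contributes `-1` and the
cutoff at distance `R` only `O(1 / R)`. -/
lemma exists_norm_gradient_sq_lt {d : ℝ} (hd : 0 < d) :
    ∃ u : formDomain d,
      ‖gradient d u‖ ^ 2 < Real.pi ^ 2 / (2 * d ^ 2) * ‖(u : L2 (pencil d))‖ ^ 2 := by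
  obtain ⟨C, hC⟩ := exists_bound_deriv_cutoff
  set R := d + 4 * d * C ^ 2 with hRdef
  have hdR : d ≤ R := by
    have : 0 ≤ 4 * d * C ^ 2 := by positivity
    linarith
  have hR : 0 < R := hd.trans_le hdR
  have hs := isSmoothCompact_trial hd hR
  obtain ⟨u, hu, hux, huy⟩ := hs.exists_formDomain fun p hp => trial_wall hd hp
  refine ⟨u, ?_⟩
  have key : ∀ (f : ℝ × ℝ → ℂ) (hf : MemLp f 2 (volume.restrict (pencil d))),
      ‖(hf.toLp : L2 (pencil d))‖ ^ 2 = ∫ p in pencil d, ‖f p‖ ^ 2 := by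
    intro f hf
    have h1 : ‖(hf.toLp : L2 (pencil d))‖ₑ ^ 2 = ∫⁻ p in pencil d, ‖f p‖ₑ ^ 2 := by
      rw [Lp.enorm_toLp, eLpNorm_two_sq]
    rw [lintegral_enorm_sq ((memLp_two_iff_integrable_sq_norm hf.1).1 hf), ← ofReal_norm,
      ← ENNReal.ofReal_pow (norm_nonneg _)] at h1
    exact (ENNReal.ofReal_eq_ofReal_iff (by positivity) (by positivity)).1 h1
  have int : ∀ (f : ℝ × ℝ → ℂ), MemLp f 2 (volume.restrict (pencil d)) →
      Integrable (fun p => ‖f p‖ ^ 2) (volume.restrict (pencil d)) := fun f hf =>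
    (memLp_two_iff_integrable_sq_norm hf.1).1 hf
  have i0 := (int _ (hs.memLp (pencil d))).const_mul (Real.pi ^ 2 / (2 * d ^ 2))
  have i1 := int _ (hs.memLp_partial (pencil d) (1, 0))
  have i2 := int _ (hs.memLp_partial (pencil d) (0, 1))
  have i3 : Integrable (fun p => ‖fderiv ℝ (trial d R) p (1, 0)‖ ^ 2 +
      ‖fderiv ℝ (trial d R) p (0, 1)‖ ^ 2) (volume.restrict (pencil d)) := i1.add i2
  have hm : MeasurableSet (pencil d) := (isClosed_pencil d).measurableSet
  have hi : IntegrableOn (trialDensity d R) (pencil d) :=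
    (i3.sub i0).congr ((ae_restrict_mem hm).mono fun p hp => trialDensity_eq hd hR hp)
  have h1 : ‖gradient d u‖ ^ 2 - Real.pi ^ 2 / (2 * d ^ 2) * ‖(u : L2 (pencil d))‖ ^ 2 =
      ∫ p in pencil d, trialDensity d R p := by
    rw [norm_gradient_sq, hux, huy, hu, key, key, key, ← integral_const_mul, ← integral_add i1 i2,
      ← integral_sub i3 i0]
    exact setIntegral_congr_fun hm fun p hp => trialDensity_eq hd hR hp
  have h2 := integral_pencil_trialDensity_le hd hdR hC hi
  have h3 : 4 * d * C ^ 2 / R < 1 := by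
    rw [div_lt_one hR]
    linarith
  linarith

end Trial

end PencilSpectrum

end

theorem mainTheorem9 (d : ℝ) (hd : 0 < d) :
    IsSelfAdjoint (PencilSpectrum.pencilLaplacian d) ∧
    (PencilSpectrum.discreteSpectrum (PencilSpectrum.pencilLaplacian d)).Nonempty ∧
    ∃ E : ℝ, (E : ℂ) ∈ PencilSpectrum.discreteSpectrum (PencilSpectrum.pencilLaplacian d) ∧
      E < Real.pi ^ 2 / (2 * d ^ 2) := by
  obtain ⟨u₀, hu₀⟩ := PencilSpectrum.exists_norm_gradient_sq_lt hd
  obtain ⟨h1, E, hE, hlt⟩ := PencilSpectrum.isSelfAdjoint_and_exists_mem_discreteSpectrum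
    (fun u v => PencilSpectrum.form_eq_inner_gradient u v) (PencilSpectrum.dense_formDomain d)
    (PencilSpectrum.isClosed_hilbertGraph_gradient d)
    (by positivity : 0 < 1 + Real.pi ^ 2 / (2 * d ^ 2))
    (fun u hu => PencilSpectrum.le_norm_gradient_sq hd u hu) hu₀
  exact ⟨h1, ⟨E, hE⟩, E, hE, hlt⟩
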